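/- Let $f(x)=\sum_{j=1}^n f_j(x)$ on $\mathbb R^d$, $f_j(x)=\mathbb E[g_j(x;\zeta_j)]$, and let $x^*$ be a minimizer of $f$. Assume: (O) $f$ is differentiable and $\mu$-strongly convex for some $\mu>0$, i.e. $f(y)\ge f(x)+\langle\nabla f(x),y-x\rangle+\frac{\mu}{2}\|x-y\|^2$ for all $x,y$; for some $c>0$, $\|\nabla f(x)-\nabla^2 f(x^*)(x-x^*)\|\le c\|x-x^*\|^2$ for all $x\in\mathbb R^d$; for each $i$, $g_i(\cdot;\zeta_i)$ is differentiable and there are constants $p>2$, $U_1>0$ and a positive random variable $L_i(\zeta_i)$ with $\mathbb E[L_i^p(\zeta_i)]<\infty$ such that, for all $x,y\in\mathbb R^d$, $\mathbb E\|\nabla g_i(x;\zeta_i)-\nabla f_i(x)\|^p\le U_1^{p/2}$ and $\|\nabla g_i(x;\zeta_i)-\nabla g_i(y;\zeta_i)\|\le L_i(\zeta_i)\|x-y\|$. (M) $\mathbf A\in\mathbb R^{n\times n}$ is nonnegative and row stochastic, $\mathbf B\in\mathbb R^{n\times n}$ is nonnegative and column stochastic, both have positive diagonal entries, and the directed graphs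 induced by $\mathbf A$ and $\mathbf B^\intercal$ (edge $(j,i)$ when the entry in row $i$, column $j$ is positive) have spanning trees with a common root. Let $u,v\ge 0$ with $u^\intercal\mathbf A=u^\intercal$, $\mathbf Bv=v$, $u^\intercal\mathbf 1=\mathbf 1^\intercal v=n$. For each $i$ let $\zeta_{i,0},\zeta_{i,1},\dots$ be samples distributed as $\zeta_i$, such that the vectors $(\zeta_{1,k},\dots,\zeta_{n,k})$, $k\ge 0$, are independent. Given $x_0=(x_{1,0},\dots,x_{n,0})\in\mathbb R^{nd}$, let $$x_{k+1}=(\mathbf A\otimes\mathbf I_d)x_k-\alpha_k y_k,\qquad y_{k+1}=(\mathbf B\otimes\mathbf I_d)y_k+\nabla G_{k+1}-\nabla G_k,\qquad y_0=\nabla G_0,$$ $$y'_{k+1}=(\mathbf B\otimes\mathbf I_d)y'_k+\nabla F_{k+1}-\nabla F_k,\qquad y'_0=\nabla F_0,$$ where $\nabla G_k$ and $\nabla F_k$ concatenate the vectors $\nabla g_i(x_{i,k};\zeta_{i,k})$ and $\nabla f_i(x_{i,k})$ respectively. Let $\alpha_k=a/(k+b)^\alpha$ with $\alpha\in(1/2,1]$,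 where $a,b>0$ satisfy $\frac{a}{b^\alpha}\le\min\{1,\frac{n}{u^\intercal v\,L}\}$ with $L=\max_{1\le i\le n}\sqrt{\mathbb E[L_i^2(\zeta_i)]}$. Put $\bar x_k=(\frac{u^\intercal}{n}\otimes\mathbf I_d)x_k$ and $\bar y'_k=(\frac{\mathbf 1^\intercal}{n}\otimes\mathbf I_d)y'_k$. Then there is a constant $U_2>0$ such that for all $k\ge 0$ $$\mathbb E\|\bar x_k-x^*\|^2\le U_2,\qquad \mathbb E\|x_k-\mathbf 1\otimes\bar x_k\|^2\le U_2\alpha_k^2,\qquad \mathbb E\|y'_k-v\otimes\bar y'_k\|^2\le U_2\alpha_k^2 .$$ -/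

import Mathlib

open MeasureTheory ProbabilityTheory

namespace SAB

/-- `ℝ^d` with the Euclidean norm. -/
abbrev Vec (d : ℕ) : Type := EuclideanSpace ℝ (Fin d)

/-- `ℝ^{nd}` with the Euclidean norm, seen as `n` stacked blocks of `ℝ^d` (block `i` belongs to
agent `i`). -/
abbrev Stacked (n d : ℕ) : Type := PiLp 2 (fun _ : Fin n => Vec d)

/-- Multiplication of a stacked vector by `M ⊗ I_d`. -/
noncomputable def kronId {n d : ℕ} (M : Matrix (Fin n) (Fin n) ℝ) (x : Stacked n d) :
    Stacked n d :=
  WithLp.toLp 2 (fun i => ∑ j, M i j • x j)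

/-- The stacked vector `w ⊗ z` for `w ∈ ℝ^n`, `z ∈ ℝ^d`. -/
noncomputable def kronVec {n d : ℕ} (w : Fin n → ℝ) (z : Vec d) : Stacked n d :=
  WithLp.toLp 2 (fun i => w i • z)

/-- The weighted average `(wᵀ / n ⊗ I_d) x`. -/
noncomputable def wAvg {n d : ℕ} (w : Fin n → ℝ) (x : Stacked n d) : Vec d :=
  ∑ i, (w i / (n : ℝ)) • x i

/-- The concatenation of the local gradients `∇ h_i (x_i)`. -/
noncomputable def gradStack {n d : ℕ} (h : Fin n → Vec d → ℝ) (x : Stacked n d) : Stacked n d :=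
  WithLp.toLp 2 (fun i => gradient (h i) (x i))

/-- The step size `α_k = a / (k + b) ^ s`. -/
noncomputable def stepSize (a b s : ℝ) (k : ℕ) : ℝ := a / ((k : ℝ) + b) ^ s

/-- The pair `(x_k, y_k)` of the algorithm, along one realization `z i k` of the samples:
`x_{k+1} = (A ⊗ I) x_k - α_k y_k` and `y_{k+1} = (B ⊗ I) y_k + ∇G_{k+1} - ∇G_k`, `y_0 = ∇G_0`,
where `∇G_k` concatenates the `∇ g_i (x_{i,k}, z_{i,k})`. -/
noncomputable def iter {n d : ℕ} {Ξ : Fin n → Type*} (A B : Matrix (Fin n) (Fin n) ℝ)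
    (g : (i : Fin n) → Vec d → Ξ i → ℝ) (α : ℕ → ℝ) (x₀ : Stacked n d)
    (z : (i : Fin n) → ℕ → Ξ i) : ℕ → Stacked n d × Stacked n d
  | 0 => (x₀, gradStack (fun i w => g i w (z i 0)) x₀)
  | k + 1 =>
    let x := (iter A B g α x₀ z k).1
    let y := (iter A B g α x₀ z k).2
    let x' := kronId A x - α k • y
    (x', kronId B y + gradStack (fun i w => g i w (z i (k + 1))) x'
      - gradStack (fun i w => g i w (z i k)) x)

/-- The iterate `x_k`. -/
noncomputable def iterX {n d : ℕ} {Ξ : Fin n → Type*} (A B : Matrix (Fin n) (Fin n) ℝ)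
    (g : (i : Fin n) → Vec d → Ξ i → ℝ) (α : ℕ → ℝ) (x₀ : Stacked n d)
    (z : (i : Fin n) → ℕ → Ξ i) (k : ℕ) : Stacked n d :=
  (iter A B g α x₀ z k).1

/-- The noise-free tracker `y'_{k+1} = (B ⊗ I) y'_k + c_{k+1} - c_k`, `y'_0 = c_0`, driven by a
sequence `c_k` of stacked vectors. -/
noncomputable def tracker {n d : ℕ} (B : Matrix (Fin n) (Fin n) ℝ) (c : ℕ → Stacked n d) :
    ℕ → Stacked n d
  | 0 => c 0
  | k + 1 => kronId B (tracker B c k) + c (k + 1) - c k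

/-- The local cost `f_i (x) = E[g_i (x; ζ_i)]`. -/
noncomputable def localCost {n d : ℕ} {Ξ : Fin n → Type*} {Ω : Type*} [MeasurableSpace Ω]
    (P : Measure Ω) (g : (i : Fin n) → Vec d → Ξ i → ℝ) (ζ : (i : Fin n) → Ω → Ξ i)
    (i : Fin n) (x : Vec d) : ℝ :=
  ∫ ω, g i x (ζ i ω) ∂P

/-- The global cost `f = ∑_j f_j`. -/
noncomputable def cost {n d : ℕ} {Ξ : Fin n → Type*} {Ω : Type*} [MeasurableSpace Ω]
    (P : Measure Ω) (g : (i : Fin n) → Vec d → Ξ i → ℝ) (ζ : (i : Fin n) → Ω → Ξ i)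
    (x : Vec d) : ℝ :=
  ∑ j, localCost P g ζ j x

/-- `L = max_i sqrt (E[L_i(ζ_i)^2])`. -/
noncomputable def lipConst {n : ℕ} {Ξ : Fin n → Type*} {Ω : Type*} [MeasurableSpace Ω]
    (P : Measure Ω) (ζ : (i : Fin n) → Ω → Ξ i) (Lip : (i : Fin n) → Ξ i → ℝ) : ℝ :=
  ⨆ i, Real.sqrt (∫ ω, Lip i (ζ i ω) ^ 2 ∂P)

/-- The assumption on the objective: the global cost is differentiable and strongly convex, has a
quadratic first-order expansion of its gradient at the optimal solution `xs`, and the sampled local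
costs are differentiable with gradient noise of bounded `p`-th moment and random Lipschitz
constants `Lip i (ζ i)` with finite `p`-th moment, for some `p > 2`. -/
structure ObjectiveAssumption {n d : ℕ} {Ξ : Fin n → Type*} {Ω : Type*} [MeasurableSpace Ω]
    (P : Measure Ω) (g : (i : Fin n) → Vec d → Ξ i → ℝ) (ζ : (i : Fin n) → Ω → Ξ i)
    (Lip : (i : Fin n) → Ξ i → ℝ) (xs : Vec d) : Prop where
  differentiable : Differentiable ℝ (cost P g ζ)
  strongly_convex : ∃ μ : ℝ, 0 < μ ∧ ∀ x y : Vec d,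
    cost P g ζ x + inner ℝ (gradient (cost P g ζ) x) (y - x) + μ / 2 * ‖x - y‖ ^ 2
      ≤ cost P g ζ y
  hessian_exists : DifferentiableAt ℝ (gradient (cost P g ζ)) xs
  hessian_bound : ∃ c : ℝ, 0 < c ∧ ∀ x : Vec d,
    ‖gradient (cost P g ζ) x - fderiv ℝ (gradient (cost P g ζ)) xs (x - xs)‖
      ≤ c * ‖x - xs‖ ^ 2
  sample_differentiable : ∀ i, ∀ z : Ξ i, Differentiable ℝ (fun x => g i x z)
  lip_pos : ∀ i, ∀ z : Ξ i, 0 < Lip i z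
  sample_lipschitz : ∀ i, ∀ z : Ξ i, ∀ x y : Vec d,
    ‖gradient (fun w => g i w z) x - gradient (fun w => g i w z) y‖ ≤ Lip i z * ‖x - y‖
  moments : ∀ i, ∃ p U₁ : ℝ, 2 < p ∧ 0 < U₁ ∧
    (∀ x : Vec d,
      Integrable (fun ω =>
        ‖gradient (fun w => g i w (ζ i ω)) x - gradient (localCost P g ζ i) x‖ ^ p) P ∧
      ∫ ω, ‖gradient (fun w => g i w (ζ i ω)) x - gradient (localCost P g ζ i) x‖ ^ p ∂P
        ≤ U₁ ^ (p / 2)) ∧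
    Integrable (fun ω => Lip i (ζ i ω) ^ p) P

/-- The edge relation `E j i` of the directed graph induced by a nonnegative matrix `M`: there is an
edge from `j` to `i` (agent `i` receives from agent `j`) iff `M i j > 0`. -/
def edge {n : ℕ} (M : Matrix (Fin n) (Fin n) ℝ) (j i : Fin n) : Prop := 0 < M i j

/-- `T` is a directed spanning tree, with root `r`, of the digraph with edge relation `E`. -/
structure IsSpanningTree {V : Type*} (E T : V → V → Prop) (r : V) : Prop where
  sub : ∀ j i, T j i → E j i
  root : ∀ j, ¬ T j r
  parent : ∀ i, i ≠ r → ∃! j, T j i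
  reach : ∀ i, Relation.ReflTransGen T r i

/-- The set of roots of all spanning trees of a digraph. -/
def roots {V : Type*} (E : V → V → Prop) : Set V := {r | ∃ T, IsSpanningTree E T r}

/-- The assumption on the weight matrices: `A` is nonnegative and row stochastic, `B` is nonnegative
and column stochastic, both have positive diagonals, and the graphs of `A` and `Bᵀ` have a common
root of spanning trees. -/
structure MatrixAssumption {n : ℕ} (A B : Matrix (Fin n) (Fin n) ℝ) : Prop where
  A_nonneg : ∀ i j, 0 ≤ A i j
  B_nonneg : ∀ i j, 0 ≤ B i j
  A_row : ∀ i, ∑ j, A i j = 1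
  B_col : ∀ j, ∑ i, B i j = 1
  A_diag : ∀ i, 0 < A i i
  B_diag : ∀ i, 0 < B i i
  common_root : (roots (edge A) ∩ roots (edge B.transpose)).Nonempty

end SAB

namespace SAB

/-! A tracker depends linearly on the sequence driving it (`tracker_add`), so the stochastic tracker
splits as y_k = y'_k + e_k, where e_k tracks the gradient noise ε_k alone. The iterate x_k depends
only on samples before time k, so it is independent of the k-th sample, and the moment bound at
fixed points carries over to ε_k (`exists_noise_bound`). Column stochasticity gives 1ᵀe_k = 1ᵀε_k,
and the remaining part of e_k contracts under B with bounded input, so e_k is bounded in L²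
(`exists_tracker_noise_bound`). The argument uses only the size of the noise, never cancellation.

Along each path let X be the distance of the u-average to the optimum, and C, Y the disagreements of
x and y'. Powers of A and B approach rank-one projections by a Doeblin argument at a root, so in
adapted norms C and Y contract by a fixed ρ < 1. The u-average follows a gradient step of f with
step α_k uᵀv/n²; here uᵀv > 0 because of the common root, and strong convexity contracts X by 1 - c
α_k. The perturbations are of order α_k (1 + ‖e_k‖ + X + C + Y), plus a term K C in the recursion
for Y (`exists_one_step_bounds`).

Minkowski's inequality turns these linear inequalities into the same ones for L² norms
(`exists_second_moment_bound`). If X ≤ M, then C and Y are forced down to order (1 + M) α_k, because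
the ratio α_k/α_{k+1} tends to 1. The input to X is then α_k (K + o(1)(1 + M)), which the
contraction c α_k M absorbs for large M, so the induction closes (`coupled_recursion_bound`). It
starts once the steps are small, and finitely many earlier indices only enlarge the constant. -/

theorem IsSpanningTree.reflTransGen {V : Type*} {E T : V → V → Prop} {r : V}
    (h : IsSpanningTree E T r) (i : V) : Relation.ReflTransGen E r i :=
  Relation.ReflTransGen.mono h.sub _ _ (h.reach i)

/-! ### Powers of stochastic matrices -/

section Stochastic

variable {n : ℕ} {M : Matrix (Fin n) (Fin n) ℝ}

theorem pow_entry_nonneg (hM : ∀ i j, 0 ≤ M i j) (m : ℕ) (i j : Fin n) : 0 ≤ (M ^ m) i j := by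
  induction m generalizing i j with
  | zero => rw [pow_zero, Matrix.one_apply]; split_ifs <;> norm_num
  | succ m ih =>
    rw [pow_succ', Matrix.mul_apply]
    exact Finset.sum_nonneg fun l _ => mul_nonneg (hM i l) (ih l j)

theorem pow_row_sum {c : ℝ} (hM : ∀ i, ∑ j, M i j = c) (m : ℕ) (i : Fin n) :
    ∑ j, (M ^ m) i j = c ^ m := by
  induction m generalizing i with
  | zero => simp [Matrix.one_apply]
  | succ m ih =>
    simp_rw [pow_succ', Matrix.mul_apply]
    rw [Finset.sum_comm]
    simp_rw [← Finset.mul_sum, ih, ← Finset.sum_mul, hM]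

theorem pow_entry_pos_succ (hM : ∀ i j, 0 ≤ M i j) {m : ℕ} {i l r : Fin n} (hil : 0 < M i l)
    (h : 0 < (M ^ m) l r) : 0 < (M ^ (m + 1)) i r := by
  rw [pow_succ', Matrix.mul_apply]
  exact Finset.sum_pos' (fun j _ => mul_nonneg (hM i j) (pow_entry_nonneg hM m j r))
    ⟨l, Finset.mem_univ _, mul_pos hil h⟩

theorem pow_entry_pos_mono (hM : ∀ i j, 0 ≤ M i j) (hd : ∀ i, 0 < M i i) {m m' : ℕ}
    (hm : m ≤ m') {i r : Fin n} (h : 0 < (M ^ m) i r) : 0 < (M ^ m') i r := by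
  induction m', hm using Nat.le_induction with
  | base => exact h
  | succ m' _ ih => exact pow_entry_pos_succ hM (hd i) ih

theorem exists_pow_entry_pos (hM : ∀ i j, 0 ≤ M i j) {r i : Fin n}
    (h : Relation.ReflTransGen (edge M) r i) : ∃ m, 0 < (M ^ m) i r := by
  induction h with
  | refl => exact ⟨0, by simp⟩
  | tail _ hbc ih =>
    obtain ⟨m, hm⟩ := ih
    exact ⟨m + 1, pow_entry_pos_succ hM hbc hm⟩

/-- A power of a nonnegative matrix with positive diagonal has a positive column at every root. -/
theorem exists_pow_column_pos (hM : ∀ i j, 0 ≤ M i j) (hd : ∀ i, 0 < M i i) {r : Fin n}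
    (hr : r ∈ roots (edge M)) : ∃ m, 1 ≤ m ∧ ∀ i, 0 < (M ^ m) i r := by
  obtain ⟨T, hT⟩ := hr
  choose m hm using fun i => exists_pow_entry_pos hM (hT.reflTransGen i)
  -- Positive diagonals keep positive entries positive in higher powers, so any exponent above all
  -- the `m i` serves every row at once.
  refine ⟨(∑ i, m i) + 1, by omega, fun i => pow_entry_pos_mono hM hd ?_ (hm i)⟩
  exact (Finset.single_le_sum (f := m) (fun _ _ => Nat.zero_le _) (Finset.mem_univ i)).trans
    (Nat.le_succ _)

theorem vecMul_pow_eq {u : Fin n → ℝ} (hu : Matrix.vecMul u M = u) (m : ℕ) :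
    Matrix.vecMul u (M ^ m) = u := by
  induction m with
  | zero => simp
  | succ m ih => rw [pow_succ, ← Matrix.vecMul_vecMul, ih, hu]

/-- Since `u` is fixed by every power of `M`, its entry at `r` is a combination of a positive column
with the nonnegative weights `u`, which are not all zero. -/
theorem leftEigenvector_pos_of_mem_roots (hM : ∀ i j, 0 ≤ M i j) (hd : ∀ i, 0 < M i i)
    {u : Fin n → ℝ} (hu0 : ∀ i, 0 ≤ u i) (hu : Matrix.vecMul u M = u) (hus : ∑ i, u i = (n : ℝ))
    {r : Fin n} (hr : r ∈ roots (edge M)) : 0 < u r := by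
  obtain ⟨m, -, hm⟩ := exists_pow_column_pos hM hd hr
  have hn : (0 : ℝ) < ∑ i, u i := by rw [hus]; exact_mod_cast r.pos
  obtain ⟨i, -, hi⟩ : ∃ i ∈ Finset.univ, 0 < u i := by
    by_contra! hcon
    exact absurd (Finset.sum_nonpos hcon) (not_le.2 hn)
  rw [← congrFun (vecMul_pow_eq hu m) r, Matrix.vecMul, dotProduct]
  exact Finset.sum_pos' (fun j _ => mul_nonneg (hu0 j) (hm j).le)
    ⟨i, Finset.mem_univ _, mul_pos hi (hm i)⟩

/-- Subtracting a fraction of a positive column leaves a matrix with smaller row sums, and powers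
change only by matrices with constant columns. -/
theorem exists_pow_eq_add_constant {S : Matrix (Fin n) (Fin n) ℝ} (hS1 : ∀ i, ∑ j, S i j = 1)
    (δ : ℝ) (r : Fin n) (k : ℕ) : ∃ w : Fin n → ℝ, ∀ i j,
      (S ^ k) i j = ((Matrix.of fun i j => S i j - if j = r then δ else 0) ^ k) i j + w j := by
  set Q : Matrix (Fin n) (Fin n) ℝ := Matrix.of fun i j => S i j - if j = r then δ else 0 with hQ
  induction k with
  | zero => exact ⟨0, fun i j => by simp⟩
  | succ k ih =>
    obtain ⟨w, hw⟩ := ih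
    -- Rows of `S` sum to one, so the part with constant columns survives. Writing `S` as `Q` plus
    -- `δ` in column `r` adds `δ` times row `r` of `Q ^ k`, which does not depend on `i` either.
    refine ⟨fun j => δ * (Q ^ k) r j + w j, fun i j => ?_⟩
    rw [pow_succ', pow_succ', Matrix.mul_apply, Matrix.mul_apply]
    have h1 : ∀ l, S i l = Q i l + if l = r then δ else 0 := fun l => by simp [hQ]
    simp_rw [hw, mul_add, Finset.sum_add_distrib, ← Finset.sum_mul, hS1, h1, add_mul,
      Finset.sum_add_distrib]
    simp
    ring

/-- The powers of a stochastic matrix converge to the rank-one matrix of its left eigenvector. -/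
theorem exists_pow_sub_lt (hM : ∀ i j, 0 ≤ M i j) (hM1 : ∀ i, ∑ j, M i j = 1)
    (hd : ∀ i, 0 < M i i) {u : Fin n → ℝ} (hu0 : ∀ i, 0 ≤ u i) (hu : Matrix.vecMul u M = u)
    (hus : ∑ i, u i = (n : ℝ)) {r : Fin n} (hr : r ∈ roots (edge M)) {ε : ℝ} (hε : 0 < ε) :
    ∃ N, 1 ≤ N ∧ ∀ i j, |(M ^ N) i j - u j / n| ≤ ε := by
  have hn : (0 : ℝ) < n := by exact_mod_cast r.pos
  obtain ⟨m, hm1, hm⟩ := exists_pow_column_pos hM hd hr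
  have : Nonempty (Fin n) := ⟨r⟩
  set S := M ^ m with hS
  have hS0 : ∀ i j, 0 ≤ S i j := pow_entry_nonneg hM m
  have hS1 : ∀ i, ∑ j, S i j = 1 := fun i => by rw [hS, pow_row_sum hM1, one_pow]
  obtain ⟨i₀, hi₀⟩ := Finite.exists_min fun i => S i r
  -- Doeblin's argument: removing the smallest entry `δ` of the positive column leaves a nonnegative
  -- `Q` with row sums `1 - δ`, whose powers vanish geometrically.
  set δ := S i₀ r with hδ
  have hδ0 : 0 < δ := hm i₀
  have hδ1 : δ ≤ 1 := by
    rw [← hS1 i₀]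
    exact Finset.single_le_sum (f := fun j => S i₀ j) (fun j _ => hS0 i₀ j) (Finset.mem_univ r)
  obtain ⟨k, hk⟩ := exists_pow_lt_of_lt_one (half_pos hε) (sub_lt_self 1 hδ0)
  set Q : Matrix (Fin n) (Fin n) ℝ := Matrix.of fun i j => S i j - if j = r then δ else 0 with hQ
  have hQ0 : ∀ i j, 0 ≤ Q i j := fun i j => by
    by_cases h : j = r
    · simpa [hQ, h] using hi₀ i
    · simpa [hQ, h] using hS0 i j
  have hQ1 : ∀ i, ∑ j, Q i j = 1 - δ := fun i => by simp [hQ, hS1]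
  have hk' : (1 - δ) ^ (k + 1) ≤ ε / 2 :=
    (pow_le_pow_of_le_one (by linarith) (by linarith) (Nat.le_succ k)).trans hk.le
  have hQk0 := pow_entry_nonneg hQ0 (k + 1)
  have hQk : ∀ i j, (Q ^ (k + 1)) i j ≤ ε / 2 := fun i j => by
    refine le_trans ?_ hk'
    rw [← pow_row_sum hQ1 (k + 1) i]
    exact Finset.single_le_sum (f := fun j => (Q ^ (k + 1)) i j) (fun j _ => hQk0 i j)
      (Finset.mem_univ j)
  obtain ⟨w, hw⟩ := exists_pow_eq_add_constant hS1 δ r (k + 1)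
  refine ⟨m * (k + 1), by nlinarith, fun i j => ?_⟩
  rw [pow_mul, ← hS, hw, ← hQ]
  -- Averaging the rows of `S ^ (k + 1)` against `u` gives `u` back, so the unknown constant `w j`
  -- cancels in the difference to be bounded.
  have h1 : u j / n = (∑ l, u l * (Q ^ (k + 1)) l j) / n + w j := by
    have h2 := congrFun (vecMul_pow_eq hu (m * (k + 1))) j
    rw [Matrix.vecMul, dotProduct] at h2
    simp_rw [pow_mul, ← hS, hw, ← hQ, mul_add, Finset.sum_add_distrib, ← Finset.sum_mul, hus] at h2
    rw [← h2]
    field_simp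
  have h3 : 0 ≤ (∑ l, u l * (Q ^ (k + 1)) l j) / n :=
    div_nonneg (Finset.sum_nonneg fun l _ => mul_nonneg (hu0 l) (hQk0 l j)) hn.le
  have h4 : (∑ l, u l * (Q ^ (k + 1)) l j) / n ≤ ε / 2 := by
    rw [div_le_iff₀ hn, mul_comm, ← hus, Finset.sum_mul]
    exact Finset.sum_le_sum fun l _ => mul_le_mul_of_nonneg_left (hQk l j) (hu0 l)
  rw [h1, abs_le]
  constructor <;> linarith [hQk i j, hQk0 i j]

/-- All mixed products of `M` and `J` collapse to `J`. Convergence of `M ^ N` to `J` thus becomes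
smallness of a power of the single operator `M - J`. -/
theorem sub_pow_of_absorbing {J : Matrix (Fin n) (Fin n) ℝ} (h1 : M * J = J) (h2 : J * M = J)
    (h3 : J * J = J) {N : ℕ} (hN : 1 ≤ N) : (M - J) ^ N = M ^ N - J := by
  have hJ : ∀ N : ℕ, J * M ^ N = J := fun N => by
    induction N with
    | zero => simp
    | succ N ih => rw [pow_succ', ← mul_assoc, h2, ih]
  induction N, hN using Nat.le_induction with
  | base => simp
  | succ N _ ih =>
    rw [pow_succ', pow_succ', ih, sub_mul, mul_sub, mul_sub, h1, h3, hJ]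
    abel

/-- The rank-one matrix `1 uᵀ / n`. -/
noncomputable def avgMatrix (u : Fin n → ℝ) : Matrix (Fin n) (Fin n) ℝ :=
  Matrix.of fun _ j => u j / n

theorem mul_avgMatrix (hM1 : ∀ i, ∑ j, M i j = 1) (u : Fin n → ℝ) :
    M * avgMatrix u = avgMatrix u := by
  ext i j
  simp [Matrix.mul_apply, avgMatrix, ← Finset.sum_mul, hM1]

theorem avgMatrix_mul {u : Fin n → ℝ} (hu : Matrix.vecMul u M = u) :
    avgMatrix u * M = avgMatrix u := by
  ext i j
  have := congrFun hu j
  rw [Matrix.vecMul, dotProduct] at this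
  simp only [Matrix.mul_apply, avgMatrix, Matrix.of_apply]
  simp_rw [div_mul_eq_mul_div]
  rw [← Finset.sum_div, this]

theorem avgMatrix_row_sum {u : Fin n → ℝ} (hus : ∑ i, u i = (n : ℝ)) (i : Fin n) :
    ∑ j, avgMatrix u i j = 1 := by
  have hn : (n : ℝ) ≠ 0 := by exact_mod_cast i.pos.ne'
  simp [avgMatrix, ← Finset.sum_div, hus, hn]

/-- The sum of absolute entries dominates the operator norm of the Kronecker lift, see
`norm_kronId_le`; n² entries of size 1/(2n²) sum to one half. -/
theorem exists_sub_avgMatrix_pow_sum_lt_one (hM : ∀ i j, 0 ≤ M i j) (hM1 : ∀ i, ∑ j, M i j = 1)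
    (hd : ∀ i, 0 < M i i) {u : Fin n → ℝ} (hu0 : ∀ i, 0 ≤ u i) (hu : Matrix.vecMul u M = u)
    (hus : ∑ i, u i = (n : ℝ)) {r : Fin n} (hr : r ∈ roots (edge M)) :
    ∃ N, 1 ≤ N ∧ ∑ i, ∑ j, |((M - avgMatrix u) ^ N) i j| < 1 := by
  have hn : (0 : ℝ) < n := by exact_mod_cast r.pos
  obtain ⟨N, hN, h⟩ := exists_pow_sub_lt hM hM1 hd hu0 hu hus hr
    (show (0 : ℝ) < 1 / (2 * n ^ 2) by positivity)
  refine ⟨N, hN, ?_⟩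
  rw [sub_pow_of_absorbing (mul_avgMatrix hM1 u) (avgMatrix_mul hu)
    (mul_avgMatrix (avgMatrix_row_sum hus) u) hN]
  calc ∑ i, ∑ j, |(M ^ N - avgMatrix u) i j|
      ≤ ∑ _i : Fin n, ∑ _j : Fin n, 1 / (2 * (n : ℝ) ^ 2) :=
        Finset.sum_le_sum fun i _ => Finset.sum_le_sum fun j _ => by
          simpa [avgMatrix] using h i j
    _ = 1 / 2 := by
        simp only [Finset.sum_const, Finset.card_univ, Fintype.card_fin, nsmul_eq_mul]
        field_simp
    _ < 1 := by norm_num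

end Stochastic

/-! ### Adapted norms -/

/-- A continuous linear map with a power of norm less than one is a strict contraction for an
equivalent norm. -/
theorem exists_contracting_seminorm {E : Type*} [NormedAddCommGroup E] [NormedSpace ℝ E]
    (T : E →L[ℝ] E) {N : ℕ} (hN : 1 ≤ N) {q : ℝ} (hq : q < 1) (hT : ∀ z, ‖(T ^ N) z‖ ≤ q * ‖z‖) :
    ∃ (p : Seminorm ℝ E) (ρ c : ℝ), 0 ≤ ρ ∧ ρ < 1 ∧ 0 < c ∧ (∀ z, ‖z‖ ≤ p z) ∧
      (∀ z, p z ≤ c * ‖z‖) ∧ ∀ z, p (T z) ≤ ρ * p z := by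
  -- The given `q` may be zero or negative; the maximum makes its `N`-th root positive.
  set q' := max q (1 / 2) with hq'
  have hq'0 : 0 < q' := lt_max_of_lt_right (by norm_num)
  have hq'1 : q' < 1 := max_lt hq (by norm_num)
  set ρ : ℝ := q' ^ ((N : ℝ)⁻¹) with hρ
  have hρ0 : 0 < ρ := Real.rpow_pos_of_pos hq'0 _
  have hρ1 : ρ < 1 := Real.rpow_lt_one hq'0.le hq'1 (by positivity)
  have hρN : ρ ^ N = q' := Real.rpow_inv_natCast_pow hq'0.le (by omega)
  -- Applying `T` shifts this weighted orbit sum by one place and gains a factor `ρ`. The new last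
  -- term is at most the lost first term `‖z‖`, because `ρ ^ N = q'`.
  let p : Seminorm ℝ E := Seminorm.of (fun z => ∑ m ∈ Finset.range N, (ρ ^ m)⁻¹ * ‖(T ^ m) z‖)
    (fun y z => by
      simp_rw [← Finset.sum_add_distrib, ← mul_add, map_add]
      exact Finset.sum_le_sum fun m _ =>
        mul_le_mul_of_nonneg_left (norm_add_le _ _) (by positivity))
    (fun t z => by
      simp_rw [map_smul, norm_smul, Finset.mul_sum]
      exact Finset.sum_congr rfl fun m _ => by ring)
  have hp : ∀ z, p z = ∑ m ∈ Finset.range N, (ρ ^ m)⁻¹ * ‖(T ^ m) z‖ := fun _ => rfl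
  refine ⟨p, ρ, 1 + ∑ m ∈ Finset.range N, (ρ ^ m)⁻¹ * ‖T ^ m‖, hρ0.le, hρ1,
    add_pos_of_pos_of_nonneg one_pos (Finset.sum_nonneg fun m _ => by positivity), fun z => ?_,
    fun z => ?_, fun z => ?_⟩
  · rw [hp]
    refine le_trans ?_ (Finset.single_le_sum
      (f := fun m => (ρ ^ m)⁻¹ * ‖(T ^ m) z‖) (fun m _ => by positivity)
      (Finset.mem_range.2 (show 0 < N by omega)))
    simp
  · rw [hp, add_mul, Finset.sum_mul]
    refine le_add_of_nonneg_of_le (by positivity) (Finset.sum_le_sum fun m _ => ?_)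
    rw [mul_assoc]
    exact mul_le_mul_of_nonneg_left ((T ^ m).le_opNorm z) (by positivity)
  · have h1 : p (T z) = ρ * ∑ m ∈ Finset.range N, (ρ ^ (m + 1))⁻¹ * ‖(T ^ (m + 1)) z‖ := by
      rw [hp, Finset.mul_sum]
      refine Finset.sum_congr rfl fun m _ => ?_
      rw [pow_succ T m]
      rw [show (T ^ m * T) z = (T ^ m) (T z) from rfl, pow_succ ρ m]
      field_simp
    rw [h1, hp]
    refine mul_le_mul_of_nonneg_left ?_ hρ0.le
    have h2 := Finset.sum_range_succ' (fun m => (ρ ^ m)⁻¹ * ‖(T ^ m) z‖) N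
    rw [Finset.sum_range_succ] at h2
    have h3 : (ρ ^ N)⁻¹ * ‖(T ^ N) z‖ ≤ ‖z‖ := by
      rw [hρN, inv_mul_le_iff₀ hq'0]
      exact (hT z).trans (mul_le_mul_of_nonneg_right (le_max_left _ _) (norm_nonneg _))
    have h4 : (ρ ^ 0)⁻¹ * ‖(T ^ 0) z‖ = ‖z‖ := by simp
    linarith

/-! ### Matrices acting on stacked vectors -/

section Kron

variable {n d : ℕ}

theorem norm_block_le (x : Stacked n d) (i : Fin n) : ‖x i‖ ≤ ‖x‖ :=
  PiLp.norm_apply_le x i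

theorem norm_le_sum_block (x : Stacked n d) : ‖x‖ ≤ ∑ i, ‖x i‖ := by
  rw [PiLp.norm_eq_of_L2]
  refine Real.sqrt_le_iff.2 ⟨Finset.sum_nonneg fun i _ => norm_nonneg _, ?_⟩
  exact Finset.sum_sq_le_sq_sum_of_nonneg fun i _ => norm_nonneg _

theorem norm_kronId_le (M : Matrix (Fin n) (Fin n) ℝ) (x : Stacked n d) :
    ‖kronId M x‖ ≤ (∑ i, ∑ j, |M i j|) * ‖x‖ := by
  refine (norm_le_sum_block (kronId M x)).trans ?_
  rw [Finset.sum_mul]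
  refine Finset.sum_le_sum fun i _ => ?_
  rw [Finset.sum_mul, show kronId M x i = ∑ j, M i j • x j from rfl]
  refine (norm_sum_le _ _).trans (Finset.sum_le_sum fun j _ => ?_)
  rw [norm_smul, Real.norm_eq_abs]
  exact mul_le_mul_of_nonneg_left (norm_block_le x j) (abs_nonneg _)

/-- The operator `M ⊗ I_d` as a continuous linear map. -/
noncomputable def kronCLM (d : ℕ) {n : ℕ} (M : Matrix (Fin n) (Fin n) ℝ) :
    Stacked n d →L[ℝ] Stacked n d :=
  LinearMap.mkContinuous
    { toFun := kronId M
      map_add' := fun x y => by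
        ext i : 1
        simp [kronId, smul_add, Finset.sum_add_distrib]
      map_smul' := fun c x => by
        ext i : 1
        simp [kronId, Finset.smul_sum, smul_comm c] } _ (norm_kronId_le M)

theorem kronCLM_apply (M : Matrix (Fin n) (Fin n) ℝ) (x : Stacked n d) :
    kronCLM d M x = kronId M x := rfl

theorem kronCLM_apply_apply (M : Matrix (Fin n) (Fin n) ℝ) (x : Stacked n d) (i : Fin n) :
    kronCLM d M x i = ∑ j, M i j • x j := rfl

theorem kronCLM_mul (M M' : Matrix (Fin n) (Fin n) ℝ) :
    kronCLM d (M * M') = kronCLM d M * kronCLM d M' := by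
  ext1 x
  ext i : 1
  simp only [mul_apply_eq_comp, kronCLM_apply_apply, Matrix.mul_apply,
    Finset.smul_sum, Finset.sum_smul, smul_smul]
  exact Finset.sum_comm

theorem kronCLM_one : kronCLM d (1 : Matrix (Fin n) (Fin n) ℝ) = 1 := by
  ext1 x
  ext i : 1
  simp [kronCLM_apply_apply, Matrix.one_apply, ite_smul]

theorem kronCLM_sub (M M' : Matrix (Fin n) (Fin n) ℝ) :
    kronCLM d (M - M') = kronCLM d M - kronCLM d M' := by
  ext1 x
  ext i : 1
  simp [kronCLM_apply_apply, sub_smul, Finset.sum_sub_distrib]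

theorem kronCLM_pow (M : Matrix (Fin n) (Fin n) ℝ) (m : ℕ) :
    kronCLM d (M ^ m) = kronCLM d M ^ m := by
  induction m with
  | zero => simp [kronCLM_one]
  | succ m ih => rw [pow_succ, pow_succ, kronCLM_mul, ih]

theorem norm_wAvg_le (w : Fin n → ℝ) (x : Stacked n d) :
    ‖wAvg w x‖ ≤ (∑ i, |w i / n|) * ‖x‖ := by
  rw [wAvg, Finset.sum_mul]
  refine (norm_sum_le _ _).trans (Finset.sum_le_sum fun j _ => ?_)
  rw [norm_smul, Real.norm_eq_abs]
  exact mul_le_mul_of_nonneg_left (norm_block_le x j) (abs_nonneg _)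

/-- The weighted average as a continuous linear map. -/
noncomputable def wAvgCLM (d : ℕ) {n : ℕ} (w : Fin n → ℝ) : Stacked n d →L[ℝ] Vec d :=
  LinearMap.mkContinuous
    { toFun := wAvg w
      map_add' := fun x y => by simp [wAvg, smul_add, Finset.sum_add_distrib]
      map_smul' := fun c x => by simp [wAvg, Finset.smul_sum, smul_comm c] } _ (norm_wAvg_le w)

theorem wAvgCLM_apply (w : Fin n → ℝ) (x : Stacked n d) : wAvgCLM d w x = wAvg w x := rfl

theorem norm_kronVec_le (w : Fin n → ℝ) (z : Vec d) :
    ‖kronVec w z‖ ≤ (∑ i, |w i|) * ‖z‖ := by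
  refine (norm_le_sum_block (kronVec w z)).trans_eq ?_
  simp [kronVec, norm_smul, Finset.sum_mul]

/-- `z ↦ w ⊗ z` as a continuous linear map. -/
noncomputable def kronVecCLM (d : ℕ) {n : ℕ} (w : Fin n → ℝ) : Vec d →L[ℝ] Stacked n d :=
  LinearMap.mkContinuous
    { toFun := kronVec w
      map_add' := fun x y => by ext i : 1; simp [kronVec, smul_add]
      map_smul' := fun c x => by ext i : 1; simp [kronVec, smul_comm c] } _ (norm_kronVec_le w)

theorem kronVecCLM_apply (w : Fin n → ℝ) (x : Vec d) : kronVecCLM d w x = kronVec w x := rfl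

theorem kronVec_one_wAvg (u : Fin n → ℝ) (x : Stacked n d) :
    kronVec 1 (wAvg u x) = kronCLM d (avgMatrix u) x := by
  ext i : 1
  simp [kronCLM_apply_apply, kronVec, wAvg, avgMatrix]

theorem kronVec_wAvg_one (v : Fin n → ℝ) (x : Stacked n d) :
    kronVec v (wAvg 1 x) = kronCLM d (avgMatrix v).transpose x := by
  ext i : 1
  simp [kronCLM_apply_apply, kronVec, wAvg, avgMatrix, Finset.smul_sum, smul_smul, div_eq_mul_inv]

theorem wAvg_kronVec {w w' : Fin n → ℝ} (z : Vec d) :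
    wAvg w (kronVec w' z) = ((∑ i, w i * w' i) / n) • z := by
  simp [wAvg, kronVec, smul_smul, Finset.sum_div, Finset.sum_smul, div_mul_eq_mul_div]

theorem wAvg_kronId_left {u : Fin n → ℝ} {M : Matrix (Fin n) (Fin n) ℝ}
    (hu : Matrix.vecMul u M = u) (x : Stacked n d) : wAvg u (kronId M x) = wAvg u x := by
  simp only [wAvg, kronId, Finset.smul_sum, smul_smul]
  rw [Finset.sum_comm]
  refine Finset.sum_congr rfl fun j _ => ?_
  rw [← Finset.sum_smul]
  congr 1
  have := congrFun hu j
  rw [Matrix.vecMul, dotProduct] at this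
  simp_rw [div_mul_eq_mul_div]
  rw [← Finset.sum_div, this]

/-- A mixing matrix `M` with averaging matrix `J` contracts disagreements in an equivalent norm. -/
theorem exists_contracting_seminorm_kron (M J : Matrix (Fin n) (Fin n) ℝ) (hMJ : M * J = J)
    (hJM : J * M = J) (hJJ : J * J = J)
    (h : ∃ N, 1 ≤ N ∧ ∑ i, ∑ j, |((M - J) ^ N) i j| < 1) :
    ∃ (p : Seminorm ℝ (Stacked n d)) (ρ c : ℝ), 0 ≤ ρ ∧ ρ < 1 ∧ 0 < c ∧ (∀ z, ‖z‖ ≤ p z) ∧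
      (∀ z, p z ≤ c * ‖z‖) ∧
      ∀ z, p (kronCLM d M z - kronCLM d J (kronCLM d M z)) ≤ ρ * p (z - kronCLM d J z) := by
  obtain ⟨N, hN, hlt⟩ := h
  obtain ⟨p, ρ, c, hρ0, hρ1, hc, h1, h2, h3⟩ :=
    exists_contracting_seminorm (kronCLM d (M - J)) hN hlt fun z => by
      rw [← kronCLM_pow]; exact norm_kronId_le _ z
  refine ⟨p, ρ, c, hρ0, hρ1, hc, h1, h2, fun z => ?_⟩
  -- Both sides agree because `(M - J)(z - J z) = M z - J M z`, by the three absorption identities.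
  refine le_trans (le_of_eq ?_) (h3 _)
  congr 1
  have e1 : kronCLM d J (kronCLM d M z) = kronCLM d J z := by
    rw [← mul_apply_eq_comp, ← kronCLM_mul, hJM]
  have e2 : kronCLM d M (kronCLM d J z) = kronCLM d J z := by
    rw [← mul_apply_eq_comp, ← kronCLM_mul, hMJ]
  have e3 : kronCLM d J (kronCLM d J z) = kronCLM d J z := by
    rw [← mul_apply_eq_comp, ← kronCLM_mul, hJJ]
  rw [kronCLM_sub]
  simp only [sub_apply, map_sub, e1, e2, e3]
  abel

theorem exists_row_contraction {A : Matrix (Fin n) (Fin n) ℝ} (hA : ∀ i j, 0 ≤ A i j)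
    (hA1 : ∀ i, ∑ j, A i j = 1) (hd : ∀ i, 0 < A i i) {u : Fin n → ℝ} (hu0 : ∀ i, 0 ≤ u i)
    (hu : Matrix.vecMul u A = u) (hus : ∑ i, u i = (n : ℝ)) {r : Fin n}
    (hr : r ∈ roots (edge A)) :
    ∃ (p : Seminorm ℝ (Stacked n d)) (ρ c : ℝ), 0 ≤ ρ ∧ ρ < 1 ∧ 0 < c ∧ (∀ z, ‖z‖ ≤ p z) ∧
      (∀ z, p z ≤ c * ‖z‖) ∧
      ∀ z, p (kronId A z - kronVec 1 (wAvg u (kronId A z))) ≤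
        ρ * p (z - kronVec 1 (wAvg u z)) := by
  simp_rw [kronVec_one_wAvg, ← kronCLM_apply]
  exact exists_contracting_seminorm_kron A (avgMatrix u) (mul_avgMatrix hA1 u) (avgMatrix_mul hu)
    (mul_avgMatrix (avgMatrix_row_sum hus) u)
    (exists_sub_avgMatrix_pow_sum_lt_one hA hA1 hd hu0 hu hus hr)

/-- The transpose of `B` is row stochastic with left eigenvector `v`, and the sum of absolute
entries is invariant under transposition. -/
theorem exists_column_contraction {B : Matrix (Fin n) (Fin n) ℝ} (hB : ∀ i j, 0 ≤ B i j)
    (hB1 : ∀ j, ∑ i, B i j = 1) (hd : ∀ i, 0 < B i i) {v : Fin n → ℝ} (hv0 : ∀ i, 0 ≤ v i)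
    (hv : Matrix.mulVec B v = v) (hvs : ∑ i, v i = (n : ℝ)) {r : Fin n}
    (hr : r ∈ roots (edge B.transpose)) :
    ∃ (p : Seminorm ℝ (Stacked n d)) (ρ c : ℝ), 0 ≤ ρ ∧ ρ < 1 ∧ 0 < c ∧ (∀ z, ‖z‖ ≤ p z) ∧
      (∀ z, p z ≤ c * ‖z‖) ∧
      ∀ z, p (kronId B z - kronVec v (wAvg 1 (kronId B z))) ≤
        ρ * p (z - kronVec v (wAvg 1 z)) := by
  have hv' : Matrix.vecMul v B.transpose = v := by rw [Matrix.vecMul_transpose, hv]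
  have h1 := mul_avgMatrix (M := B.transpose) hB1 v
  have h2 := avgMatrix_mul hv'
  have h3 := mul_avgMatrix (avgMatrix_row_sum hvs) v
  obtain ⟨N, hN, hlt⟩ := exists_sub_avgMatrix_pow_sum_lt_one (M := B.transpose)
    (fun i j => hB j i) hB1 hd hv0 hv' hvs hr
  simp_rw [kronVec_wAvg_one, ← kronCLM_apply]
  refine exists_contracting_seminorm_kron B (avgMatrix v).transpose ?_ ?_ ?_ ⟨N, hN, ?_⟩
  · simpa using congrArg Matrix.transpose h2
  · simpa using congrArg Matrix.transpose h1
  · simpa using congrArg Matrix.transpose h3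
  · have : (B - (avgMatrix v).transpose) ^ N = ((B.transpose - avgMatrix v) ^ N).transpose := by
      rw [Matrix.transpose_pow, Matrix.transpose_sub, Matrix.transpose_transpose]
    rw [this, Finset.sum_comm]
    exact hlt

end Kron

/-! ### Smoothness of expected costs and gradient steps -/

section Gradient

variable {d : ℕ}

theorem norm_fderiv_sub_eq {F : Type*} [NormedAddCommGroup F] [InnerProductSpace ℝ F]
    [CompleteSpace F] (f h : F → ℝ) (x y : F) :
    ‖fderiv ℝ f x - fderiv ℝ h y‖ = ‖gradient f x - gradient h y‖ := by
  rw [gradient, gradient, ← map_sub, LinearIsometryEquiv.norm_map]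

theorem fderiv_eq_toDual_gradient {F : Type*} [NormedAddCommGroup F] [InnerProductSpace ℝ F]
    [CompleteSpace F] (f : F → ℝ) (x : F) :
    fderiv ℝ f x = InnerProductSpace.toDual ℝ F (gradient f x) := by
  simp [gradient]

/-- Each coordinate of the gradient is a pointwise limit of difference quotients with increments `1
/ m`, and these are measurable in the sample. -/
theorem measurable_gradient_param {Ξ : Type*} [MeasurableSpace Ξ] {h : Vec d → Ξ → ℝ}
    (hm : ∀ x, Measurable (h x)) (hd : ∀ z, Differentiable ℝ fun x => h x z) (x : Vec d) :
    Measurable fun z => gradient (fun w => h w z) x := by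
  have h1 : ∀ j : Fin d, Measurable fun z => gradient (fun w => h w z) x j := fun j => by
    have e : ∀ z, gradient (fun w => h w z) x j =
        fderiv ℝ (fun w => h w z) x (EuclideanSpace.single j 1) := fun z => by
      rw [fderiv_eq_toDual_gradient, InnerProductSpace.toDual_apply_apply,
        EuclideanSpace.inner_single_right]
      simp
    simp_rw [e]
    refine measurable_of_tendsto_metrizable
      (f := fun (m : ℕ) z => (m : ℝ) • (h (x + (m : ℝ)⁻¹ • EuclideanSpace.single j 1) z - h x z))
      (fun m => Measurable.const_mul ((hm _).sub (hm _)) (m : ℝ)) (tendsto_pi_nhds.2 fun z => ?_)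
    exact ((hd z x).hasFDerivAt.lim_real _).comp tendsto_natCast_atTop_atTop
  exact (WithLp.measurable_toLp 2 _).comp (measurable_pi_lambda _ h1)

/-- A Carathéodory function, continuous in the point and measurable in the sample, is jointly
measurable. This is needed to evaluate it at a random iterate. -/
theorem measurable_uncurry_gradient {Ξ : Type*} [MeasurableSpace Ξ] {h : Vec d → Ξ → ℝ}
    (hm : ∀ x, Measurable (h x)) (hd : ∀ z, Differentiable ℝ fun x => h x z) {Lip : Ξ → ℝ}
    (hL : ∀ z x y, ‖gradient (fun w => h w z) x - gradient (fun w => h w z) y‖ ≤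
      Lip z * ‖x - y‖) :
    Measurable (Function.uncurry fun x z => gradient (fun w => h w z) x) :=
  measurable_uncurry_of_continuous_of_measurable
    (fun z => (LipschitzWith.of_dist_le_mul (K := (Lip z).toNNReal) fun x y => by
      rw [dist_eq_norm, dist_eq_norm]
      exact (hL z x y).trans
        (mul_le_mul_of_nonneg_right (Real.le_coe_toNNReal _) (norm_nonneg _))).continuous)
    (measurable_gradient_param hm hd)

theorem sq_le_one_add_rpow {t p : ℝ} (ht : 0 ≤ t) (hp : 2 ≤ p) : t ^ 2 ≤ 1 + t ^ p := by
  rcases le_total t 1 with h | h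
  · have := Real.rpow_nonneg ht p
    nlinarith
  · have := Real.rpow_le_rpow_of_exponent_le h hp
    rw [Real.rpow_two] at this
    linarith

theorem le_one_add_rpow {t p : ℝ} (ht : 0 ≤ t) (hp : 2 ≤ p) : t ≤ 1 + t ^ p := by
  rcases le_total t 1 with h | h
  · have := Real.rpow_nonneg ht p
    linarith
  · have := Real.rpow_le_rpow_of_exponent_le h (one_le_two.trans hp)
    rw [Real.rpow_one] at this
    linarith

/-- An expectation of randomly smooth functions is differentiable, with Lipschitz gradient. -/
theorem differentiable_lipschitz_integral {Ω Ξ : Type*} [MeasurableSpace Ω]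
    (P : Measure Ω) {h : Vec d → Ξ → ℝ} {ζ : Ω → Ξ}
    (hint : ∀ x, Integrable (fun ω => h x (ζ ω)) P)
    (hd : ∀ z, Differentiable ℝ fun x => h x z) {Lip : Ξ → ℝ}
    (hL : ∀ z x y, ‖gradient (fun w => h w z) x - gradient (fun w => h w z) y‖ ≤
      Lip z * ‖x - y‖)
    (hLint : Integrable (fun ω => Lip (ζ ω)) P) (hL0 : ∀ z, 0 ≤ Lip z)
    (hgint : ∀ x, Integrable (fun ω => gradient (fun w => h w (ζ ω)) x) P) :
    Differentiable ℝ (fun x => ∫ ω, h x (ζ ω) ∂P) ∧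
      ∀ x y, ‖gradient (fun x => ∫ ω, h x (ζ ω) ∂P) x - gradient (fun x => ∫ ω, h x (ζ ω) ∂P) y‖
        ≤ (∫ ω, Lip (ζ ω) ∂P) * ‖x - y‖ := by
  have hFint : ∀ x, Integrable (fun ω => fderiv ℝ (fun w => h w (ζ ω)) x) P := fun x => by
    simp_rw [fderiv_eq_toDual_gradient]
    exact (InnerProductSpace.toDual ℝ (Vec d)).toContinuousLinearEquiv.toContinuousLinearMap
      |>.integrable_comp (hgint x)
  have hder : ∀ x, HasFDerivAt (fun x => ∫ ω, h x (ζ ω) ∂P)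
      (∫ ω, fderiv ℝ (fun w => h w (ζ ω)) x ∂P) x := fun x => by
    -- On the unit ball around `x` the derivative differs from its value at `x` by at most the
    -- random Lipschitz modulus, which yields an integrable majorant.
    refine hasFDerivAt_integral_of_dominated_of_fderiv_le
      (F' := fun x ω => fderiv ℝ (fun w => h w (ζ ω)) x)
      (bound := fun ω => ‖fderiv ℝ (fun w => h w (ζ ω)) x‖ + Lip (ζ ω))
      (Metric.ball_mem_nhds x one_pos) (.of_forall fun y => (hint y).aestronglyMeasurable)
      (hint x) (hFint x).aestronglyMeasurable (.of_forall fun ω y hy => ?_)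
      ((hFint x).norm.add hLint) (.of_forall fun ω y _ => (hd (ζ ω) y).hasFDerivAt)
    have h1 := norm_fderiv_sub_eq (fun w => h w (ζ ω)) (fun w => h w (ζ ω)) y x
    have h2 := hL (ζ ω) y x
    have h3 : ‖y - x‖ ≤ 1 := by rw [← dist_eq_norm]; exact (Metric.mem_ball.1 hy).le
    have h4 := norm_add_le (fderiv ℝ (fun w => h w (ζ ω)) x)
      (fderiv ℝ (fun w => h w (ζ ω)) y - fderiv ℝ (fun w => h w (ζ ω)) x)
    rw [add_sub_cancel] at h4
    nlinarith [hL0 (ζ ω)]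
  refine ⟨fun x => (hder x).differentiableAt, fun x y => ?_⟩
  rw [← norm_fderiv_sub_eq, (hder x).fderiv, (hder y).fderiv, ← integral_sub (hFint x) (hFint y),
    ← integral_mul_const]
  refine (norm_integral_le_integral_norm _).trans ?_
  refine integral_mono ((hFint x).sub (hFint y)).norm (hLint.mul_const _) fun ω => ?_
  rw [norm_fderiv_sub_eq]
  exact hL (ζ ω) x y

/-- Gradient steps of a smooth strongly convex function contract towards the minimizer. -/
theorem exists_gradient_step_contraction {F : Type*} [NormedAddCommGroup F]
    [InnerProductSpace ℝ F] [CompleteSpace F] {f : F → ℝ} {μ ℓ : ℝ} (hμ : 0 < μ)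
    (hsc : ∀ x y, f x + inner ℝ (gradient f x) (y - x) + μ / 2 * ‖x - y‖ ^ 2 ≤ f y)
    (hℓ : ∀ x y, ‖gradient f x - gradient f y‖ ≤ ℓ * ‖x - y‖) {xs : F} (hxs : ∀ x, f xs ≤ f x) :
    ∃ c γ₀ : ℝ, 0 < c ∧ 0 < γ₀ ∧ ∀ γ x, 0 ≤ γ → γ ≤ γ₀ →
      ‖x - γ • gradient f x - xs‖ ≤ (1 - c * γ) * ‖x - xs‖ := by
  have h0 : gradient f xs = 0 := by
    rw [gradient, IsLocalMin.fderiv_eq_zero (.of_forall hxs), map_zero]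
  -- The first bound on `γ` makes the quadratic term at most half of the gain `γ μ`, so the squared
  -- factor is at most `1 - γ μ / 2 ≤ (1 - γ μ / 4) ^ 2`. The second keeps `1 - γ μ / 4`
  -- nonnegative, as taking roots requires.
  refine ⟨μ / 4, min (μ / 2 / (ℓ ^ 2 + 1)) (4 / μ), by positivity, by positivity,
    fun γ x hγ hγ' => ?_⟩
  have hγ1 : γ * (ℓ ^ 2 + 1) ≤ μ / 2 := by
    rw [← le_div_iff₀ (by positivity)]; exact hγ'.trans (min_le_left _ _)
  have hγ2 : γ * μ ≤ 4 := by
    rw [← le_div_iff₀ hμ]; exact hγ'.trans (min_le_right _ _)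
  have hin : μ / 2 * ‖x - xs‖ ^ 2 ≤ inner ℝ (x - xs) (gradient f x) := by
    have h1 := hsc x xs
    have h2 := hxs x
    rw [← neg_sub x xs, inner_neg_right, real_inner_comm] at h1
    linarith
  have hgr : ‖gradient f x‖ ^ 2 ≤ ℓ ^ 2 * ‖x - xs‖ ^ 2 := by
    have h1 := hℓ x xs
    rw [h0, sub_zero] at h1
    rw [← mul_pow]
    exact pow_le_pow_left₀ (norm_nonneg _) h1 2
  refine le_of_sq_le_sq ?_ (mul_nonneg (by linarith) (norm_nonneg _))
  rw [show x - γ • gradient f x - xs = (x - xs) - γ • gradient f x by abel, norm_sub_sq_real,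
    real_inner_smul_right, norm_smul, mul_pow, mul_pow, Real.norm_eq_abs, sq_abs]
  have e1 : γ ^ 2 * ‖gradient f x‖ ^ 2 ≤ γ * (μ / 2) * ‖x - xs‖ ^ 2 := by
    calc γ ^ 2 * ‖gradient f x‖ ^ 2 ≤ γ ^ 2 * (ℓ ^ 2 * ‖x - xs‖ ^ 2) := by gcongr
      _ = γ * (γ * ℓ ^ 2) * ‖x - xs‖ ^ 2 := by ring
      _ ≤ γ * (μ / 2) * ‖x - xs‖ ^ 2 := by gcongr; linarith
  have e2 := mul_le_mul_of_nonneg_left hin hγ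
  nlinarith [sq_nonneg (μ / 4 * γ), sq_nonneg ‖x - xs‖,
    mul_nonneg (sq_nonneg (μ / 4 * γ)) (sq_nonneg ‖x - xs‖)]

end Gradient

/-! ### The scalar recursion and the step sizes -/

section Scalar

open Filter Topology

theorem exists_forall_le_of_eventually {f : ℕ → ℝ} {M : ℝ} (h : ∀ᶠ k in atTop, f k ≤ M) :
    ∃ U, ∀ k, f k ≤ U := by
  obtain ⟨U, hU⟩ := (show IsBoundedUnder (· ≤ ·) atTop f from ⟨M, h⟩).bddAbove_range
  exact ⟨U, fun k => hU ⟨k, rfl⟩⟩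

/-- A coupled linear recursion for an optimality gap `X` driven with step sizes `α`, and two
disagreements `C`, `Y` that contract up to perturbations of the order of the step size. -/
theorem coupled_recursion_bound {α X C Y : ℕ → ℝ} {c K ρ α₀ : ℝ} (hα : ∀ k, 0 < α k)
    (hα0 : Tendsto α atTop (𝓝 0)) (hratio : ∀ r : ℝ, 1 < r → ∀ᶠ k in atTop, α k ≤ r * α (k + 1))
    (hX : ∀ k, 0 ≤ X k) (hC : ∀ k, 0 ≤ C k) (hY : ∀ k, 0 ≤ Y k) (hc : 0 < c) (hK : 0 < K)
    (hα₀ : 0 < α₀) (hρ0 : 0 ≤ ρ) (hρ1 : ρ < 1)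
    (h1 : ∀ k, α k ≤ α₀ → X (k + 1) ≤ (1 - c * α k) * X k + K * α k * (C k + Y k + 1))
    (h2 : ∀ k, C (k + 1) ≤ ρ * C k + K * α k * (1 + X k + C k + Y k))
    (h3 : ∀ k, Y (k + 1) ≤ ρ * Y k + K * C k + K * α k * (1 + X k + C k + Y k)) :
    ∃ U : ℝ, 0 < U ∧ ∀ k, X k ≤ U ∧ C k ≤ U * α k ∧ Y k ≤ U * α k := by
  -- In `W = C + θ Y` the coupling term `K * C k` of `h3`, which carries no step size, is weighted
  -- so as to cost only a third of the gap `1 - ρ`.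
  set θ : ℝ := min 1 ((1 - ρ) / 3 / K) with hθ
  have hθ0 : 0 < θ := lt_min one_pos (div_pos (div_pos (by linarith) (by norm_num)) hK)
  have hθ1 : θ ≤ 1 := min_le_left _ _
  have hθK : θ * K ≤ (1 - ρ) / 3 := by
    rw [← le_div_iff₀ hK]; exact min_le_right _ _
  set W : ℕ → ℝ := fun k => C k + θ * Y k with hW
  have hW0 : ∀ k, 0 ≤ W k := fun k => add_nonneg (hC k) (mul_nonneg hθ0.le (hY k))
  have hCY : ∀ k, θ * (C k + Y k) ≤ W k := fun k => by
    simp only [hW]; nlinarith [hC k]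
  set ρ₁ : ℝ := (2 + ρ) / 3 with hρ₁
  -- Replacing `α k` by `r * α (k + 1)` raises the contraction factor `ρ₁` only to `(1 + ρ₁) / 2 <
  -- 1`; `Q` then solves the fixed-point equation `r (ρ₁ Q + 2 K) = Q`.
  set r : ℝ := (1 + ρ₁) / 2 / ρ₁ with hr
  have hρ₁0 : 0 < ρ₁ := by rw [hρ₁]; linarith
  have hρ₁1 : ρ₁ < 1 := by rw [hρ₁]; linarith
  have hr1 : 1 < r := by rw [hr, lt_div_iff₀ hρ₁0]; linarith
  have hrρ : r * ρ₁ = (1 + ρ₁) / 2 := by rw [hr]; field_simp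
  set Q : ℝ := 2 * K * r / ((1 - ρ₁) / 2) with hQ
  have hQ0 : 0 < Q := div_pos (by positivity) (by linarith)
  have hQ1 : Q * ((1 - ρ₁) / 2) = 2 * K * r := div_mul_cancel₀ _ (by linarith)
  have small : ∀ t : ℝ, 0 < t → ∀ᶠ k in atTop, α k ≤ t := fun t ht =>
    (hα0.eventually (gt_mem_nhds ht)).mono fun _ h => h.le
  -- The third bound lets the `C + Y` perturbations of `W` cost another third of `1 - ρ`. The fourth
  -- limits the effect of the disagreements on `X` to `c / 2 * (1 + M)` for every `M`, so `M` may be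
  -- chosen afterwards.
  have hev : ∀ᶠ k in atTop, α k ≤ α₀ ∧ α k ≤ 1 / c ∧ α k ≤ (1 - ρ) / 3 * θ / (2 * K) ∧
      α k ≤ c / 2 * θ / (K * Q) ∧ α k ≤ r * α (k + 1) :=
    (small _ hα₀).and ((small _ (by positivity)).and ((small _ (by
      have : 0 < 1 - ρ := by linarith
      positivity)).and ((small _ (by positivity)).and (hratio r hr1))))
  obtain ⟨k₀, hk₀⟩ := eventually_atTop.1 hev
  -- The outer summands start the induction for `X` and `W`. The middle one gives `c / 2 * (1 + M) +
  -- K ≤ c * M`, which keeps `X` below `M`.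
  set M : ℝ := X k₀ + (1 + 2 * K / c) + W k₀ / (Q * α k₀) with hM
  have hM1 : 1 + 2 * K / c ≤ M := by
    have := div_nonneg (hW0 k₀) (mul_pos hQ0 (hα k₀)).le
    linarith [hX k₀]
  have hMc : c + 2 * K ≤ c * M := by
    have h := mul_le_mul_of_nonneg_left hM1 hc.le
    have e : c * (1 + 2 * K / c) = c + 2 * K := by field_simp
    linarith
  have hM0 : 0 < M := lt_of_lt_of_le (by positivity) hM1
  have key : ∀ k ≥ k₀, X k ≤ M ∧ W k ≤ Q * (1 + M) * α k := by
    intro k hk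
    induction k, hk using Nat.le_induction with
    | base =>
      constructor
      · have := div_nonneg (hW0 k₀) (mul_pos hQ0 (hα k₀)).le
        have : 0 < 1 + 2 * K / c := by positivity
        linarith
      · have h : W k₀ / (Q * α k₀) ≤ 1 + M := by
          have : 0 < 1 + 2 * K / c := by positivity
          linarith [hX k₀]
        rw [div_le_iff₀ (mul_pos hQ0 (hα k₀))] at h
        linarith
    | succ k hk ih =>
      obtain ⟨ihX, ihW⟩ := ih
      obtain ⟨e1, e2, e3, e4, e5⟩ := hk₀ k hk
      have ak := hα k
      constructor
      · have f1 : c * α k ≤ 1 := by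
          rw [le_div_iff₀ hc] at e2; linarith
        have f2 : K * (C k + Y k) ≤ c / 2 * (1 + M) := by
          have g1 : θ * (C k + Y k) ≤ Q * (1 + M) * α k := (hCY k).trans ihW
          rw [le_div_iff₀ (by positivity)] at e4
          have g2 : θ * (K * (C k + Y k)) ≤ θ * (c / 2 * (1 + M)) := by
            calc θ * (K * (C k + Y k)) = K * (θ * (C k + Y k)) := by ring
              _ ≤ K * (Q * (1 + M) * α k) := by gcongr
              _ = (α k * (K * Q)) * (1 + M) := by ring
              _ ≤ (c / 2 * θ) * (1 + M) := by gcongr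
              _ = _ := by ring
          exact le_of_mul_le_mul_left g2 hθ0
        have f3 : (1 - c * α k) * X k ≤ (1 - c * α k) * M := by gcongr
        have f4 : α k * (K * (C k + Y k) + K) ≤ α k * (c * M) := by gcongr; linarith
        linarith [h1 k e1]
      · have f1 : 2 * K * α k * (C k + Y k) ≤ (1 - ρ) / 3 * W k := by
          rw [le_div_iff₀ (by positivity)] at e3
          have hcy : 0 ≤ C k + Y k := add_nonneg (hC k) (hY k)
          calc 2 * K * α k * (C k + Y k) = (α k * (2 * K)) * (C k + Y k) := by ring
            _ ≤ ((1 - ρ) / 3 * θ) * (C k + Y k) := by gcongr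
            _ = (1 - ρ) / 3 * (θ * (C k + Y k)) := by ring
            _ ≤ _ := mul_le_mul_of_nonneg_left (hCY k) (by linarith)
        have f2 : W (k + 1) ≤ ρ₁ * W k + 2 * K * α k * (1 + X k) := by
          have g1 := h2 k
          have g2 := mul_le_mul_of_nonneg_left (h3 k) hθ0.le
          have g3 : θ * K * C k ≤ (1 - ρ) / 3 * C k := mul_le_mul_of_nonneg_right hθK (hC k)
          have g4 : θ * (K * α k * (1 + X k + C k + Y k)) ≤ 1 * (K * α k * (1 + X k + C k + Y k)) :=
            mul_le_mul_of_nonneg_right hθ1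
              (by have := hX k; have := hC k; have := hY k; positivity)
          have g5 : (1 - ρ) / 3 * C k ≤ (1 - ρ) / 3 * W k :=
            mul_le_mul_of_nonneg_left (by simp only [hW]; linarith [mul_nonneg hθ0.le (hY k)])
              (by linarith)
          have g6 : ρ₁ * W k = ρ * (C k + θ * Y k) + (1 - ρ) / 3 * W k + (1 - ρ) / 3 * W k := by
            simp only [hW, hρ₁]; ring
          have g7 : W (k + 1) = C (k + 1) + θ * Y (k + 1) := rfl
          rw [g6, g7]
          linarith
        calc W (k + 1) ≤ ρ₁ * (Q * (1 + M) * α k) + 2 * K * α k * (1 + M) := by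
              refine f2.trans ?_
              gcongr
          _ = (ρ₁ * Q + 2 * K) * (1 + M) * α k := by ring
          _ ≤ (ρ₁ * Q + 2 * K) * (1 + M) * (r * α (k + 1)) := by gcongr
          _ = ((r * ρ₁) * Q + 2 * K * r) * (1 + M) * α (k + 1) := by ring
          _ = Q * (1 + M) * α (k + 1) := by rw [hrρ, ← hQ1]; ring
  -- Since every `α k` is positive, finitely many early ratios `f k / α k` only enlarge the
  -- constant.
  have bd : ∀ f : ℕ → ℝ, (∃ U, ∀ k ≥ k₀, f k ≤ U * α k) → ∃ U, ∀ k, f k ≤ U * α k := by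
    rintro f ⟨U, hU⟩
    obtain ⟨V, hV⟩ := exists_forall_le_of_eventually (f := fun k => f k / α k) (M := U)
      (eventually_atTop.2 ⟨k₀, fun k hk => (div_le_iff₀ (hα k)).2 (hU k hk)⟩)
    exact ⟨V, fun k => (div_le_iff₀ (hα k)).1 (hV k)⟩
  obtain ⟨U₁, hU₁⟩ := exists_forall_le_of_eventually
    (eventually_atTop.2 ⟨k₀, fun k hk => (key k hk).1⟩)
  obtain ⟨U₂, hU₂⟩ := bd C ⟨Q * (1 + M), fun k hk => le_trans
    (by simp only [hW]; linarith [mul_nonneg hθ0.le (hY k)]) (key k hk).2⟩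
  obtain ⟨U₃, hU₃⟩ := bd Y ⟨Q * (1 + M) / θ, fun k hk => by
    have := (key k hk).2
    have h' : θ * Y k ≤ Q * (1 + M) * α k := le_trans (by simp only [hW]; linarith [hC k]) this
    rw [div_mul_eq_mul_div, le_div_iff₀ hθ0]
    linarith⟩
  refine ⟨|U₁| + |U₂| + |U₃| + 1, by positivity, fun k => ⟨?_, ?_, ?_⟩⟩
  · linarith [hU₁ k, le_abs_self U₁, abs_nonneg U₂, abs_nonneg U₃]
  · refine (hU₂ k).trans (mul_le_mul_of_nonneg_right ?_ (hα k).le)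
    linarith [le_abs_self U₂, abs_nonneg U₁, abs_nonneg U₃]
  · refine (hU₃ k).trans (mul_le_mul_of_nonneg_right ?_ (hα k).le)
    linarith [le_abs_self U₃, abs_nonneg U₁, abs_nonneg U₂]

theorem stepSize_pos {a b s : ℝ} (ha : 0 < a) (hb : 0 < b) (k : ℕ) : 0 < stepSize a b s k :=
  div_pos ha (Real.rpow_pos_of_pos (by positivity) _)

theorem tendsto_stepSize {a b s : ℝ} (hs : 0 < s) :
    Tendsto (stepSize a b s) atTop (𝓝 0) :=
  Tendsto.div_atTop tendsto_const_nhds <| (tendsto_rpow_atTop hs).comp <|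
    tendsto_atTop_add_const_right _ _ tendsto_natCast_atTop_atTop

/-- Once `(r - 1) k ≥ 1`, the base grows by at most a factor `r`, and `s ≤ 1` gives `r ^ s ≤ r`. -/
theorem stepSize_le_mul_succ {a b s : ℝ} (ha : 0 < a) (hb : 0 < b) (hs : 0 < s) (hs' : s ≤ 1)
    {r : ℝ} (hr : 1 < r) : ∀ᶠ k in atTop, stepSize a b s k ≤ r * stepSize a b s (k + 1) := by
  obtain ⟨k₀, hk₀⟩ := exists_nat_ge (1 / (r - 1))
  filter_upwards [eventually_ge_atTop k₀] with k hk
  have hk1 : 1 ≤ (r - 1) * k := by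
    rw [← div_le_iff₀' (by linarith)]
    exact hk₀.trans (by exact_mod_cast hk)
  have hkb : 0 < (k : ℝ) + b := by positivity
  have h1 : ((k + 1 : ℕ) : ℝ) + b ≤ r * (k + b) := by push_cast; nlinarith
  have h2 : (((k + 1 : ℕ) : ℝ) + b) ^ s ≤ r * (k + b) ^ s := by
    calc (((k + 1 : ℕ) : ℝ) + b) ^ s ≤ (r * (k + b)) ^ s :=
          Real.rpow_le_rpow (by positivity) h1 hs.le
      _ = r ^ s * (k + b) ^ s := Real.mul_rpow (by linarith) hkb.le
      _ ≤ r * (k + b) ^ s := by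
          gcongr
          simpa using Real.rpow_le_rpow_of_exponent_le hr.le hs'
  have p1 : 0 < ((k : ℝ) + b) ^ s := Real.rpow_pos_of_pos hkb _
  have p2 : 0 < (((k + 1 : ℕ) : ℝ) + b) ^ s := Real.rpow_pos_of_pos (by positivity) _
  rw [stepSize, stepSize, mul_div_assoc', div_le_div_iff₀ p1 p2]
  nlinarith

end Scalar

/-! ### One-step estimates along a path -/

section Step

variable {n d : ℕ} {A B : Matrix (Fin n) (Fin n) ℝ} {u v : Fin n → ℝ}

/-- The `u`-average of `v ⊗ ȳ` is `(uᵀv / n) ȳ`: this is the part of the update that carries the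
descent direction. -/
theorem wAvg_eq_disagreement_add (u v : Fin n → ℝ) (y : Stacked n d) :
    wAvg u y = wAvg u (y - kronVec v (wAvg 1 y)) + ((∑ i, u i * v i) / n) • wAvg 1 y := by
  rw [← wAvg_kronVec, ← wAvgCLM_apply u y, ← wAvgCLM_apply u (_ - _), map_sub, wAvgCLM_apply,
    wAvgCLM_apply, sub_add_cancel]

/-- One step of the method brings the average closer to the optimum, up to disagreements and
noise. -/
theorem optimality_step {F : Stacked n d → Stacked n d} {D : Vec d → Vec d} {ℓ c γ₀ : ℝ}
    {xs : Vec d} (hn : (0 : ℝ) < n) (huv : 0 ≤ ∑ i, u i * v i) (hu : Matrix.vecMul u A = u)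
    (hF : ∀ x x', ‖F x - F x'‖ ≤ ℓ * ‖x - x'‖)
    (hFD : ∀ z, wAvg 1 (F (kronVec 1 z)) = (1 / (n : ℝ)) • D z)
    (hD : ∀ γ z, 0 ≤ γ → γ ≤ γ₀ → ‖z - γ • D z - xs‖ ≤ (1 - c * γ) * ‖z - xs‖)
    {x y e : Stacked n d} (hy : wAvg 1 y = wAvg 1 (F x)) {α : ℝ} (hα : 0 ≤ α)
    (hα' : (∑ i, u i * v i) / n ^ 2 * α ≤ γ₀) :
    ‖wAvg u (kronId A x - α • (y + e)) - xs‖ ≤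
      (1 - c * ((∑ i, u i * v i) / n ^ 2 * α)) * ‖wAvg u x - xs‖ +
        α * (‖wAvgCLM d u‖ * ‖y - kronVec v (wAvg 1 y)‖ +
          (∑ i, u i * v i) / n * (‖wAvgCLM d (1 : Fin n → ℝ)‖ *
            (ℓ * ‖x - kronVec 1 (wAvg u x)‖)) + ‖wAvgCLM d u‖ * ‖e‖) := by
  set q := ∑ i, u i * v i with hq
  set xb := wAvg u x with hxb
  -- An exact gradient step from the average, with step `q / n ^ 2 * α`: one factor `1 / n` comes
  -- from the `u`-average of `v ⊗ ȳ`, the other from `hFD`. The three errors are the tracking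
  -- disagreement, the evaluation of `F` off consensus, and the noise.
  have h1 : wAvg u (kronId A x - α • (y + e)) - xs =
      (xb - (q / n ^ 2 * α) • D xb - xs) - α • (wAvg u (y - kronVec v (wAvg 1 y)) +
        (q / n) • wAvg 1 (F x - F (kronVec 1 xb)) + wAvg u e) := by
    have e1 : wAvg u (kronId A x - α • (y + e)) = xb - α • (wAvg u y + wAvg u e) := by
      rw [hxb, ← wAvg_kronId_left hu x]
      simp only [← wAvgCLM_apply, map_sub, map_smul, map_add]
    have e2 : wAvg 1 (F x - F (kronVec 1 xb)) = wAvg 1 y - (1 / (n : ℝ)) • D xb := by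
      rw [← hFD, hy]
      simp only [← wAvgCLM_apply, map_sub]
    rw [e1, e2, wAvg_eq_disagreement_add u v y, ← hq]
    module
  have h2 := hD _ xb (mul_nonneg (div_nonneg huv (sq_nonneg _)) hα) hα'
  have h3 : ‖wAvg u (y - kronVec v (wAvg 1 y))‖ ≤ ‖wAvgCLM d u‖ * ‖y - kronVec v (wAvg 1 y)‖ :=
    (wAvgCLM d u).le_opNorm _
  have h4 : ‖(q / n) • wAvg 1 (F x - F (kronVec 1 xb))‖ ≤
      q / n * (‖wAvgCLM d (1 : Fin n → ℝ)‖ * (ℓ * ‖x - kronVec 1 xb‖)) := by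
    rw [norm_smul, Real.norm_of_nonneg (div_nonneg huv hn.le)]
    refine mul_le_mul_of_nonneg_left ?_ (div_nonneg huv hn.le)
    exact ((wAvgCLM d 1).le_opNorm _).trans
      (mul_le_mul_of_nonneg_left (hF _ _) (norm_nonneg _))
  have h5 : ‖wAvg u e‖ ≤ ‖wAvgCLM d u‖ * ‖e‖ := (wAvgCLM d u).le_opNorm _
  rw [h1]
  refine (norm_sub_le _ _).trans (add_le_add h2 ?_)
  rw [norm_smul, Real.norm_of_nonneg hα]
  refine mul_le_mul_of_nonneg_left ?_ hα
  exact (norm_add₃_le).trans (by linarith)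

theorem kronId_kronVec_one (hA1 : ∀ i, ∑ j, A i j = 1) (z : Vec d) :
    kronId A (kronVec 1 z) = kronVec 1 z := by
  ext i : 1
  simp [kronId, kronVec, ← Finset.sum_smul, hA1]

/-- The mean of `y` is that of `F x`, so beyond its disagreement `y` is controlled by Lipschitz
continuity from the optimum. The constant term remains because the blocks of `F` need not vanish
there. -/
theorem norm_tracker_le {F : Stacked n d → Stacked n d} {ℓ : ℝ} (hℓ : 0 ≤ ℓ) {xs : Vec d}
    (hF : ∀ x x', ‖F x - F x'‖ ≤ ℓ * ‖x - x'‖) {x y : Stacked n d}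
    (hy : wAvg 1 y = wAvg 1 (F x)) :
    ‖y‖ ≤ ‖y - kronVec v (wAvg 1 y)‖ + ‖kronVecCLM d v‖ * (‖wAvgCLM d (1 : Fin n → ℝ)‖ *
      (‖F (kronVec 1 xs)‖ + ℓ * (‖x - kronVec 1 (wAvg u x)‖ +
        ‖kronVecCLM d (1 : Fin n → ℝ)‖ * ‖wAvg u x - xs‖))) := by
  have h1 : ‖x - kronVec 1 xs‖ ≤ ‖x - kronVec 1 (wAvg u x)‖ +
      ‖kronVecCLM d (1 : Fin n → ℝ)‖ * ‖wAvg u x - xs‖ := by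
    have e : x - kronVec 1 xs = (x - kronVec 1 (wAvg u x)) +
        kronVecCLM d 1 (wAvg u x - xs) := by
      rw [map_sub, kronVecCLM_apply, kronVecCLM_apply]; abel
    rw [e]
    exact (norm_add_le _ _).trans (add_le_add le_rfl ((kronVecCLM d 1).le_opNorm _))
  have h2 : ‖F x‖ ≤ ‖F (kronVec 1 xs)‖ + ‖F x - F (kronVec 1 xs)‖ := by
    have := norm_add_le (F (kronVec 1 xs)) (F x - F (kronVec 1 xs))
    rwa [add_sub_cancel] at this
  have h3 : ‖kronVec v (wAvg 1 y)‖ ≤ ‖kronVecCLM d v‖ * (‖wAvgCLM d (1 : Fin n → ℝ)‖ * ‖F x‖) := by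
    rw [hy]
    exact ((kronVecCLM d v).le_opNorm _).trans
      (mul_le_mul_of_nonneg_left ((wAvgCLM d 1).le_opNorm _) (norm_nonneg _))
  have h4 : ‖y‖ ≤ ‖y - kronVec v (wAvg 1 y)‖ + ‖kronVec v (wAvg 1 y)‖ := by
    have := norm_add_le (y - kronVec v (wAvg 1 y)) (kronVec v (wAvg 1 y))
    rwa [sub_add_cancel] at this
  refine h4.trans (add_le_add le_rfl (h3.trans ?_))
  gcongr
  exact h2.trans (add_le_add le_rfl ((hF _ _).trans (mul_le_mul_of_nonneg_left h1 hℓ)))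

theorem consensus_step {p : Seminorm ℝ (Stacked n d)} {ρ c : ℝ} (hc : 0 ≤ c)
    (hp : ∀ z, p z ≤ c * ‖z‖)
    (hpA : ∀ z, p (kronId A z - kronVec 1 (wAvg u (kronId A z))) ≤
      ρ * p (z - kronVec 1 (wAvg u z))) {x y : Stacked n d} {α : ℝ} (hα : 0 ≤ α) :
    p ((kronId A x - α • y) - kronVec 1 (wAvg u (kronId A x - α • y))) ≤
      ρ * p (x - kronVec 1 (wAvg u x)) +
        α * (c * ((1 + ‖kronCLM d (avgMatrix u)‖) * ‖y‖)) := by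
  have e : (kronId A x - α • y) - kronVec 1 (wAvg u (kronId A x - α • y)) =
      (kronId A x - kronVec 1 (wAvg u (kronId A x))) -
        α • (y - kronVec 1 (wAvg u y)) := by
    simp only [kronVec_one_wAvg, map_sub, map_smul]
    module
  rw [e]
  refine (map_sub_le_add p _ _).trans (add_le_add (hpA x) ?_)
  rw [map_smul_eq_mul, Real.norm_of_nonneg hα]
  refine mul_le_mul_of_nonneg_left ((hp _).trans (mul_le_mul_of_nonneg_left ?_ hc)) hα
  rw [kronVec_one_wAvg, add_mul, one_mul]
  exact (norm_sub_le _ _).trans (add_le_add le_rfl ((kronCLM d _).le_opNorm _))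

/-- The inputs are arbitrary because the estimate serves twice: for gradients along the iterates and
for the noise. -/
theorem tracking_step {p : Seminorm ℝ (Stacked n d)} {ρ c : ℝ} (hc : 0 ≤ c)
    (hp : ∀ z, p z ≤ c * ‖z‖)
    (hpB : ∀ z, p (kronId B z - kronVec v (wAvg 1 (kronId B z))) ≤
      ρ * p (z - kronVec v (wAvg 1 z))) (y w w' : Stacked n d) :
    p ((kronId B y + w' - w) - kronVec v (wAvg 1 (kronId B y + w' - w))) ≤
      ρ * p (y - kronVec v (wAvg 1 y)) +
        c * ((1 + ‖kronCLM d (avgMatrix v).transpose‖) * ‖w' - w‖) := by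
  have e : (kronId B y + w' - w) - kronVec v (wAvg 1 (kronId B y + w' - w)) =
      (kronId B y - kronVec v (wAvg 1 (kronId B y))) +
        ((w' - w) - kronVec v (wAvg 1 (w' - w))) := by
    simp only [kronVec_wAvg_one, map_sub, map_add]
    abel
  rw [e]
  refine (map_add_le_add p _ _).trans (add_le_add (hpB y) ((hp _).trans
    (mul_le_mul_of_nonneg_left ?_ hc)))
  rw [kronVec_wAvg_one, add_mul, one_mul]
  exact (norm_sub_le _ _).trans (add_le_add le_rfl ((kronCLM d _).le_opNorm _))

/-- Row stochasticity fixes consensus vectors, so mixing moves only the disagreement. Hence the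
gradient increments are of order `C + α ‖y‖`. -/
theorem norm_increment_le (hA1 : ∀ i, ∑ j, A i j = 1) {x y : Stacked n d} {α : ℝ} (hα : 0 ≤ α) :
    ‖(kronId A x - α • y) - x‖ ≤
      (‖kronCLM d A‖ + 1) * ‖x - kronVec 1 (wAvg u x)‖ + α * ‖y‖ := by
  have e : (kronId A x - α • y) - x =
      kronCLM d A (x - kronVec 1 (wAvg u x)) - (x - kronVec 1 (wAvg u x)) - α • y := by
    rw [map_sub, kronCLM_apply, kronCLM_apply, kronId_kronVec_one hA1]
    abel
  rw [e]
  have h1 := norm_sub_le (kronCLM d A (x - kronVec 1 (wAvg u x)) - (x - kronVec 1 (wAvg u x)))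
    (α • y)
  have h2 := norm_sub_le (kronCLM d A (x - kronVec 1 (wAvg u x))) (x - kronVec 1 (wAvg u x))
  have h3 := (kronCLM d A).le_opNorm (x - kronVec 1 (wAvg u x))
  rw [norm_smul, Real.norm_of_nonneg hα] at h1
  linarith

end Step

/-! ### Trackers: linearity, conservation, measurability, independence -/

section Tracker

variable {n d : ℕ}

theorem tracker_add (B : Matrix (Fin n) (Fin n) ℝ) (c c' : ℕ → Stacked n d) (k : ℕ) :
    tracker B (fun t => c t + c' t) k = tracker B c k + tracker B c' k := by
  induction k with
  | zero => rfl
  | succ k ih =>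
    simp only [tracker, ih, ← kronCLM_apply, map_add]
    abel

/-- Column stochasticity conserves the plain average, so the increments of the input telescope. -/
theorem wAvg_one_tracker {B : Matrix (Fin n) (Fin n) ℝ} (hB : ∀ j, ∑ i, B i j = 1)
    (c : ℕ → Stacked n d) (k : ℕ) : wAvg 1 (tracker B c k) = wAvg 1 (c k) := by
  have h1 : Matrix.vecMul 1 B = 1 := by
    ext j
    simp [Matrix.vecMul, dotProduct, hB]
  induction k with
  | zero => rfl
  | succ k ih =>
    have h2 := wAvg_kronId_left h1 (tracker B c k)
    simp only [tracker]
    rw [← wAvgCLM_apply, map_sub, map_add, wAvgCLM_apply, wAvgCLM_apply, wAvgCLM_apply, h2, ih]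
    abel

variable {Ξ : Fin n → Type*} {A B : Matrix (Fin n) (Fin n) ℝ} {g : (i : Fin n) → Vec d → Ξ i → ℝ}
  {α : ℕ → ℝ} {x₀ : Stacked n d}

theorem iter_snd_eq_tracker (z : (i : Fin n) → ℕ → Ξ i) (k : ℕ) :
    (iter A B g α x₀ z k).2 = tracker B
      (fun t => gradStack (fun i w => g i w (z i t)) (iterX A B g α x₀ z t)) k := by
  induction k with
  | zero => rfl
  | succ k ih =>
    simp only [tracker, ← ih]
    rfl

theorem iterX_succ (z : (i : Fin n) → ℕ → Ξ i) (k : ℕ) :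
    iterX A B g α x₀ z (k + 1) =
      kronId A (iterX A B g α x₀ z k) - α k • (iter A B g α x₀ z k).2 := rfl

theorem iter_congr {z z' : (i : Fin n) → ℕ → Ξ i} {k : ℕ} (h : ∀ i, ∀ t ≤ k, z i t = z' i t) :
    iter A B g α x₀ z k = iter A B g α x₀ z' k := by
  induction k with
  | zero => simp only [iter, h _ 0 le_rfl]
  | succ k ih =>
    have := ih fun i t ht => h i t (ht.trans (Nat.le_succ k))
    simp only [iter, this, h _ (k + 1) le_rfl, h _ k (Nat.le_succ k)]

/-- The iterate at time `k` depends on the samples before time `k` only. -/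
theorem iterX_congr {z z' : (i : Fin n) → ℕ → Ξ i} {k : ℕ} (h : ∀ i, ∀ t < k, z i t = z' i t) :
    iterX A B g α x₀ z k = iterX A B g α x₀ z' k := by
  cases k with
  | zero => rfl
  | succ k =>
    have := iter_congr (A := A) (B := B) (g := g) (α := α) (x₀ := x₀)
      fun i t (ht : t ≤ k) => h i t (Nat.lt_succ_of_le ht)
    simp only [iterX, iter, this]

variable [∀ i, MeasurableSpace (Ξ i)]

theorem measurable_gradStack {Ω : Type*} [MeasurableSpace Ω]
    (hgm : ∀ i, Measurable (Function.uncurry fun x z => gradient (fun w => g i w z) x))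
    {X : Ω → Stacked n d} (hX : Measurable X) {z : Ω → (i : Fin n) → Ξ i} (hz : Measurable z) :
    Measurable fun ω => gradStack (fun i w => g i w (z ω i)) (X ω) := by
  refine (WithLp.measurable_toLp 2 _).comp (measurable_pi_lambda _ fun i => ?_)
  exact (hgm i).comp ((((measurable_pi_apply i).comp (WithLp.measurable_ofLp 2 _)).comp hX).prodMk
    ((measurable_pi_apply i).comp hz))

theorem measurable_iter
    (hgm : ∀ i, Measurable (Function.uncurry fun x z => gradient (fun w => g i w z) x)) (k : ℕ) :
    Measurable fun z : (i : Fin n) → ℕ → Ξ i => iter A B g α x₀ z k := by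
  have hz : ∀ t, Measurable fun (z : (i : Fin n) → ℕ → Ξ i) i => z i t := fun t =>
    measurable_pi_lambda _ fun i => (measurable_pi_apply t).comp (measurable_pi_apply i)
  induction k with
  | zero => exact measurable_const.prodMk (measurable_gradStack hgm measurable_const (hz 0))
  | succ k ih =>
    have hx : Measurable fun z : (i : Fin n) → ℕ → Ξ i =>
        kronId A (iter A B g α x₀ z k).1 - α k • (iter A B g α x₀ z k).2 :=
      ((kronCLM d A).continuous.measurable.comp ih.fst).sub (ih.snd.const_smul (α k))
    exact hx.prodMk (((((kronCLM d B).continuous.measurable.comp ih.snd)).add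
      (measurable_gradStack hgm hx (hz (k + 1)))).sub (measurable_gradStack hgm ih.fst (hz k)))

theorem indepFun_iterX {Ω : Type*} [MeasurableSpace Ω] {P : Measure Ω} [IsProbabilityMeasure P]
    (hgm : ∀ i, Measurable (Function.uncurry fun x z => gradient (fun w => g i w z) x))
    {Z : (i : Fin n) → ℕ → Ω → Ξ i} (hZ : ∀ i k, Measurable (Z i k))
    (hind : iIndepFun (fun (k : ℕ) (ω : Ω) (i : Fin n) => Z i k ω) P) (k : ℕ) :
    IndepFun (fun ω => iterX A B g α x₀ (fun i t => Z i t ω) k) (fun ω i => Z i k ω) P := by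
  -- A reference outcome fills in the samples from time `k` on, which do not affect `x_k`. This
  -- exhibits the iterate as a measurable function of the history alone.
  obtain ⟨ω₀⟩ : Nonempty Ω := nonempty_of_isProbabilityMeasure P
  have h := hind.indepFun_finset (Finset.range k) {k} (by simp)
    (fun t => measurable_pi_lambda _ fun i => hZ i t)
  have hφ : Measurable fun hist : ((t : Finset.range k) → (i : Fin n) → Ξ i) =>
      iterX A B g α x₀
        (fun i t => if ht : t ∈ Finset.range k then hist ⟨t, ht⟩ i else Z i t ω₀) k := by
    refine (measurable_iter hgm k).fst.comp
      (measurable_pi_lambda _ fun i => measurable_pi_lambda _ fun t => ?_)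
    by_cases ht : t ∈ Finset.range k
    · simp only [ht, dite_true]
      exact (measurable_pi_apply i).comp (measurable_pi_apply _)
    · simp only [ht, dite_false]
      exact measurable_const
  have hψ : Measurable fun cur : ((t : ({k} : Finset ℕ)) → (i : Fin n) → Ξ i) =>
      cur ⟨k, Finset.mem_singleton_self k⟩ := measurable_pi_apply _
  have e : (fun ω => iterX A B g α x₀ (fun i t => Z i t ω) k) = (fun hist :
      ((t : Finset.range k) → (i : Fin n) → Ξ i) => iterX A B g α x₀
        (fun i t => if ht : t ∈ Finset.range k then hist ⟨t, ht⟩ i else Z i t ω₀) k) ∘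
      fun ω t i => Z i t ω := by
    ext1 ω
    refine iterX_congr fun i t ht => ?_
    simp [ht]
  rw [e]
  exact h.comp hφ hψ

end Tracker

/-! ### Second moments at an independent random point -/

section Noise

/-- The joint law is a product, so Tonelli allows `X` to be frozen and the uniform bound applied
inside. Working in `ENNReal` requires no integrability beforehand. -/
theorem lintegral_le_of_indepFun {Ω α β : Type*} [MeasurableSpace Ω] [MeasurableSpace α]
    [MeasurableSpace β] {P : Measure Ω} [IsProbabilityMeasure P] {X : Ω → α} {Y : Ω → β}
    (hX : Measurable X) (hY : Measurable Y) (hXY : IndepFun X Y P) {H : α → β → ENNReal}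
    (hH : Measurable (Function.uncurry H)) {c : ENNReal} (hc : ∀ x, ∫⁻ ω, H x (Y ω) ∂P ≤ c) :
    ∫⁻ ω, H (X ω) (Y ω) ∂P ≤ c := by
  have h1 : ∫⁻ ω, H (X ω) (Y ω) ∂P = ∫⁻ q, Function.uncurry H q ∂(P.map fun ω => (X ω, Y ω)) :=
    (lintegral_map hH (hX.prodMk hY)).symm
  have := Measure.isProbabilityMeasure_map (μ := P) hX.aemeasurable
  have := Measure.isProbabilityMeasure_map (μ := P) hY.aemeasurable
  rw [h1, hXY.map_prod_eq_prod_map_map hX.aemeasurable hY.aemeasurable,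
    lintegral_prod _ hH.aemeasurable]
  calc ∫⁻ x, ∫⁻ y, Function.uncurry H (x, y) ∂(P.map Y) ∂(P.map X)
      ≤ ∫⁻ _x, c ∂(P.map X) := lintegral_mono fun x => by
        exact (lintegral_map (hH.comp measurable_prodMk_left) hY).trans_le (hc x)
    _ = c := by simp

theorem lintegral_enorm_sq_le_of_rpow {Ω E : Type*} [MeasurableSpace Ω] [NormedAddCommGroup E]
    {P : Measure Ω} [IsProbabilityMeasure P] {f : Ω → E} {p V : ℝ} (hp : 2 ≤ p)
    (hf : Integrable (fun ω => ‖f ω‖ ^ p) P) (hV : ∫ ω, ‖f ω‖ ^ p ∂P ≤ V) :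
    ∫⁻ ω, ‖f ω‖ₑ ^ 2 ∂P ≤ ENNReal.ofReal (1 + V) := by
  calc ∫⁻ ω, ‖f ω‖ₑ ^ 2 ∂P ≤ ∫⁻ ω, ENNReal.ofReal (1 + ‖f ω‖ ^ p) ∂P :=
        lintegral_mono fun ω => by
          rw [← ofReal_norm, ← ENNReal.ofReal_pow (norm_nonneg _)]
          exact ENNReal.ofReal_le_ofReal (sq_le_one_add_rpow (norm_nonneg _) hp)
    _ = ENNReal.ofReal (∫ ω, (1 + ‖f ω‖ ^ p) ∂P) :=
        (ofReal_integral_eq_lintegral_ofReal ((integrable_const _).add hf)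
          (.of_forall fun ω =>
            add_nonneg zero_le_one (Real.rpow_nonneg (norm_nonneg _) _))).symm
    _ ≤ ENNReal.ofReal (1 + V) := by
        rw [integral_add (integrable_const _) hf]
        simpa using ENNReal.ofReal_le_ofReal (add_le_add le_rfl hV)

theorem memLp_two_of_lintegral_le {Ω E : Type*} [MeasurableSpace Ω] [NormedAddCommGroup E]
    {P : Measure Ω} {f : Ω → E} (hf : AEStronglyMeasurable f P) {V : ℝ} (hV : 0 ≤ V)
    (h : ∫⁻ ω, ‖f ω‖ₑ ^ 2 ∂P ≤ ENNReal.ofReal V) :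
    MemLp f 2 P ∧ lpNorm f 2 P ≤ √V := by
  have h1 : eLpNorm f 2 P ≤ ENNReal.ofReal (√V) := by
    rw [eLpNorm_eq_lintegral_rpow_enorm_toReal (by norm_num) (by norm_num), Real.sqrt_eq_rpow,
      ← ENNReal.ofReal_rpow_of_nonneg hV (by norm_num)]
    simp only [ENNReal.toReal_ofNat, ENNReal.rpow_ofNat]
    exact ENNReal.rpow_le_rpow h (by norm_num)
  refine ⟨⟨hf, h1.trans_lt ENNReal.ofReal_lt_top⟩, ?_⟩
  rw [← toReal_eLpNorm hf]
  exact ENNReal.toReal_le_of_le_ofReal (Real.sqrt_nonneg _) h1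

end Noise

/-! ### Consequences of the objective assumption -/

section Objective

variable {n d : ℕ} {Ξ : Fin n → Type*} {Ω : Type*} [MeasurableSpace Ω]
  {P : Measure Ω} {g : (i : Fin n) → Vec d → Ξ i → ℝ}
  {ζ : (i : Fin n) → Ω → Ξ i} {Lip : (i : Fin n) → Ξ i → ℝ} {xs : Vec d}

theorem gradient_cost (hd : ∀ i, Differentiable ℝ (localCost P g ζ i)) (x : Vec d) :
    gradient (cost P g ζ) x = ∑ i, gradient (localCost P g ζ i) x := by
  have e : fderiv ℝ (cost P g ζ) x = ∑ i, fderiv ℝ (localCost P g ζ i) x := by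
    rw [← fderiv_fun_sum fun i _ => hd i x]
    rfl
  simp only [gradient, e, map_sum]

theorem wAvg_one_gradStack (hd : ∀ i, Differentiable ℝ (localCost P g ζ i)) (z : Vec d) :
    wAvg 1 (gradStack (localCost P g ζ) (kronVec 1 z)) =
      (1 / (n : ℝ)) • gradient (cost P g ζ) z := by
  rw [gradient_cost hd, Finset.smul_sum]
  simp [wAvg, gradStack, kronVec]

theorem gradStack_lipschitz {f : Fin n → Vec d → ℝ} {ℓ : Fin n → ℝ} (hℓ : ∀ i, 0 ≤ ℓ i)
    (hf : ∀ i x y, ‖gradient (f i) x - gradient (f i) y‖ ≤ ℓ i * ‖x - y‖) (x y : Stacked n d) :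
    ‖gradStack f x - gradStack f y‖ ≤ (∑ i, ℓ i) * ‖x - y‖ := by
  refine (norm_le_sum_block _).trans ?_
  rw [Finset.sum_mul]
  exact Finset.sum_le_sum fun i _ => (hf i (x i) (y i)).trans
    (mul_le_mul_of_nonneg_left (norm_block_le (x - y) i) (hℓ i))

theorem ObjectiveAssumption.exists_variance_bound [IsProbabilityMeasure P]
    (h : ObjectiveAssumption P g ζ Lip xs) : ∃ V : Fin n → ℝ, (∀ i, 0 ≤ V i) ∧ ∀ i x,
      ∫⁻ ω, ‖gradient (fun w => g i w (ζ i ω)) x - gradient (localCost P g ζ i) x‖ₑ ^ 2 ∂P ≤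
        ENNReal.ofReal (V i) := by
  choose p U hp hU hm _ using h.moments
  exact ⟨fun i => 1 + U i ^ (p i / 2),
    fun i => add_nonneg zero_le_one (Real.rpow_nonneg (hU i).le _),
    fun i x => lintegral_enorm_sq_le_of_rpow (hp i).le (hm i x).1 (hm i x).2⟩

theorem lpNorm_two_le_sum_block {f : Ω → Stacked n d} (hf : AEStronglyMeasurable f P)
    {c : Fin n → ℝ} (h : ∀ i, MemLp (fun ω => f ω i) 2 P ∧ lpNorm (fun ω => f ω i) 2 P ≤ c i) :
    MemLp f 2 P ∧ lpNorm f 2 P ≤ ∑ i, c i := by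
  have hsum : MemLp (∑ i, fun ω => ‖f ω i‖) 2 P := memLp_finsetSum' _ fun i _ => (h i).1.norm
  have hle : ∀ ω, ‖f ω‖ ≤ (∑ i, fun ω => ‖f ω i‖) ω := fun ω => by
    rw [Finset.sum_apply]
    exact norm_le_sum_block (f ω)
  refine ⟨hsum.mono' hf (.of_forall hle), (lpNorm_mono_real hsum hle).trans
    ((lpNorm_sum_le (fun i _ => (h i).1.norm) (by norm_num)).trans
      (Finset.sum_le_sum fun i _ => ?_))⟩
  rw [lpNorm_norm (h i).1.aestronglyMeasurable]
  exact (h i).2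

variable [∀ i, MeasurableSpace (Ξ i)]

theorem ObjectiveAssumption.measurable_gradient (h : ObjectiveAssumption P g ζ Lip xs)
    (hg : ∀ i x, Measurable (g i x)) (i : Fin n) :
    Measurable (Function.uncurry fun x z => gradient (fun w => g i w z) x) :=
  measurable_uncurry_gradient (hg i) (h.sample_differentiable i) (h.sample_lipschitz i)

/-- Moments of order `p` make the Lipschitz modulus and the sampled gradients integrable, as
differentiation under the integral requires. In the centred moment, `gradient (localCost P g ζ i) x`
serves only as a fixed vector, before differentiability is known. -/
theorem ObjectiveAssumption.localCost_smooth [IsProbabilityMeasure P]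
    (h : ObjectiveAssumption P g ζ Lip xs) (hζ : ∀ i, Measurable (ζ i))
    (hg : ∀ i x, Measurable (g i x)) (hint : ∀ i x, Integrable (fun ω => g i x (ζ i ω)) P)
    (hLip : ∀ i, Measurable (Lip i)) (i : Fin n) :
    Differentiable ℝ (localCost P g ζ i) ∧ ∀ x y,
      ‖gradient (localCost P g ζ i) x - gradient (localCost P g ζ i) y‖ ≤
        (∫ ω, Lip i (ζ i ω) ∂P) * ‖x - y‖ := by
  obtain ⟨p, U, hp, -, hm, hL⟩ := h.moments i
  have hL0 : ∀ z, 0 ≤ Lip i z := fun z => (h.lip_pos i z).le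
  refine differentiable_lipschitz_integral P (hint i) (h.sample_differentiable i)
    (h.sample_lipschitz i) ?_ hL0 fun x => ?_
  · refine ((integrable_const (1 : ℝ)).add hL).mono'
      ((hLip i).comp (hζ i)).aestronglyMeasurable (.of_forall fun ω => ?_)
    rw [Real.norm_of_nonneg (hL0 _)]
    exact le_one_add_rpow (hL0 _) hp.le
  · refine ((integrable_const (‖gradient (localCost P g ζ i) x‖ + 1)).add (hm x).1).mono'
      ((measurable_gradient_param (hg i) (h.sample_differentiable i) x).comp
        (hζ i)).aestronglyMeasurable (.of_forall fun ω => ?_)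
    have h1 := norm_add_le (gradient (localCost P g ζ i) x)
      (gradient (fun w => g i w (ζ i ω)) x - gradient (localCost P g ζ i) x)
    rw [add_sub_cancel] at h1
    have h2 := le_one_add_rpow
      (norm_nonneg (gradient (fun w => g i w (ζ i ω)) x - gradient (localCost P g ζ i) x)) hp.le
    simp only [Pi.add_apply]
    linarith

/-- The gradient noise along the iterates is bounded in `L²`. -/
theorem ObjectiveAssumption.exists_noise_bound [IsProbabilityMeasure P]
    (h : ObjectiveAssumption P g ζ Lip xs) (hζ : ∀ i, Measurable (ζ i))
    (hg : ∀ i x, Measurable (g i x)) (hint : ∀ i x, Integrable (fun ω => g i x (ζ i ω)) P)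
    (hLip : ∀ i, Measurable (Lip i)) {Z : (i : Fin n) → ℕ → Ω → Ξ i}
    (hZ : ∀ i k, Measurable (Z i k)) (hdist : ∀ i k, IdentDistrib (Z i k) (ζ i) P P)
    {x : ℕ → Ω → Stacked n d} (hx : ∀ k, Measurable (x k))
    (hind : ∀ k, IndepFun (x k) (fun ω i => Z i k ω) P) :
    ∃ σ : ℝ, 0 ≤ σ ∧ ∀ k,
      MemLp (fun ω => gradStack (fun i w => g i w (Z i k ω)) (x k ω) -
        gradStack (localCost P g ζ) (x k ω)) 2 P ∧
      lpNorm (fun ω => gradStack (fun i w => g i w (Z i k ω)) (x k ω) -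
        gradStack (localCost P g ζ) (x k ω)) 2 P ≤ σ := by
  obtain ⟨V, hV0, hV⟩ := h.exists_variance_bound
  refine ⟨∑ i, √(V i), Finset.sum_nonneg fun i _ => Real.sqrt_nonneg _, fun k => ?_⟩
  have hfm : ∀ i, Measurable (gradient (localCost P g ζ i)) := fun i =>
    (LipschitzWith.of_dist_le_mul (K := (∫ ω, Lip i (ζ i ω) ∂P).toNNReal) fun x y => by
      rw [dist_eq_norm, dist_eq_norm]
      exact ((h.localCost_smooth hζ hg hint hLip i).2 x y).trans (mul_le_mul_of_nonneg_right
        (Real.le_coe_toNNReal _) (norm_nonneg _))).continuous.measurable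
  have hxi : ∀ i, Measurable fun ω => x k ω i := fun i =>
    ((measurable_pi_apply i).comp (WithLp.measurable_ofLp 2 _)).comp (hx k)
  have hH : ∀ i, Measurable (Function.uncurry fun (y : Vec d) (z : Ξ i) =>
      gradient (fun w => g i w z) y - gradient (localCost P g ζ i) y) := fun i =>
    (h.measurable_gradient hg i).sub ((hfm i).comp measurable_fst)
  have hcomp : ∀ i, MemLp (fun ω => gradient (fun w => g i w (Z i k ω)) (x k ω i) -
        gradient (localCost P g ζ i) (x k ω i)) 2 P ∧
      lpNorm (fun ω => gradient (fun w => g i w (Z i k ω)) (x k ω i) -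
        gradient (localCost P g ζ i) (x k ω i)) 2 P ≤ √(V i) := fun i => by
    refine memLp_two_of_lintegral_le
      ((hH i).comp ((hxi i).prodMk (hZ i k))).aestronglyMeasurable (hV0 i) ?_
    refine lintegral_le_of_indepFun (hxi i) (hZ i k) ?_ (H := fun (y : Vec d) (z : Ξ i) =>
      ‖gradient (fun w => g i w z) y - gradient (localCost P g ζ i) y‖ₑ ^ 2)
      ((hH i).enorm.pow_const 2) fun y => ?_
    · exact (hind k).comp ((measurable_pi_apply i).comp (WithLp.measurable_ofLp 2 _))
        (measurable_pi_apply i)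
    · have hm : Measurable fun z : Ξ i =>
          ‖gradient (fun w => g i w z) y - gradient (localCost P g ζ i) y‖ₑ ^ 2 :=
        ((hH i).comp measurable_prodMk_left).enorm.pow_const 2
      exact (((hdist i k).comp hm).lintegral_eq).trans_le (hV i y)
  have hmeas : Measurable fun ω => gradStack (fun i w => g i w (Z i k ω)) (x k ω) -
      gradStack (localCost P g ζ) (x k ω) := by
    refine (measurable_gradStack (z := fun ω i => Z i k ω) (h.measurable_gradient hg) (hx k)
      (measurable_pi_lambda _ fun i => hZ i k)).sub ?_
    exact (WithLp.measurable_toLp 2 _).comp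
      (measurable_pi_lambda _ fun i => (hfm i).comp (hxi i))
  refine lpNorm_two_le_sum_block hmeas.aestronglyMeasurable fun i => ?_
  simp only [PiLp.sub_apply, gradStack]
  exact hcomp i

end Objective

/-! ### The coupled one-step inequalities -/

section OneStep

variable {n d : ℕ} {A B : Matrix (Fin n) (Fin n) ℝ} {u v : Fin n → ℝ}

/-- Both eigenvectors are positive at the common root. This makes the effective step of the average
positive. -/
theorem MatrixAssumption.sum_mul_pos (h : MatrixAssumption A B) (hu0 : ∀ i, 0 ≤ u i)
    (hv0 : ∀ i, 0 ≤ v i) (hu : Matrix.vecMul u A = u) (hv : Matrix.mulVec B v = v)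
    (hus : ∑ i, u i = (n : ℝ)) (hvs : ∑ i, v i = (n : ℝ)) : 0 < ∑ i, u i * v i := by
  obtain ⟨r, hrA, hrB⟩ := h.common_root
  have h1 := leftEigenvector_pos_of_mem_roots h.A_nonneg h.A_diag hu0 hu hus hrA
  have h2 := leftEigenvector_pos_of_mem_roots (M := B.transpose) (fun i j => h.B_nonneg j i)
    h.B_diag hv0 (by rw [Matrix.vecMul_transpose, hv]) hvs hrB
  exact Finset.sum_pos' (fun i _ => mul_nonneg (hu0 i) (hv0 i)) ⟨r, Finset.mem_univ _, mul_pos h1 h2⟩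

set_option maxHeartbeats 1000000 in
/-- The coupled one-step inequalities of the method, in norms adapted to the weight matrices. -/
theorem MatrixAssumption.exists_one_step_bounds (h : MatrixAssumption A B) (hu0 : ∀ i, 0 ≤ u i)
    (hv0 : ∀ i, 0 ≤ v i) (hu : Matrix.vecMul u A = u) (hv : Matrix.mulVec B v = v)
    (hus : ∑ i, u i = (n : ℝ)) (hvs : ∑ i, v i = (n : ℝ))
    {F : Stacked n d → Stacked n d} {D : Vec d → Vec d} {ℓ c γ₀ : ℝ} {xs : Vec d}
    (hℓ : 0 ≤ ℓ) (hc : 0 < c) (hγ₀ : 0 < γ₀)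
    (hF : ∀ x x', ‖F x - F x'‖ ≤ ℓ * ‖x - x'‖)
    (hFD : ∀ z, wAvg 1 (F (kronVec 1 z)) = (1 / (n : ℝ)) • D z)
    (hD : ∀ γ z, 0 ≤ γ → γ ≤ γ₀ → ‖z - γ • D z - xs‖ ≤ (1 - c * γ) * ‖z - xs‖) :
    ∃ (pA pB : Seminorm ℝ (Stacked n d)) (ρ K c' α₀ : ℝ),
      0 ≤ ρ ∧ ρ < 1 ∧ 0 < K ∧ 0 < c' ∧ 0 < α₀ ∧ (∀ z, ‖z‖ ≤ pA z) ∧ (∀ z, ‖z‖ ≤ pB z) ∧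
      (∀ z, pA z ≤ K * ‖z‖) ∧ (∀ z, pB z ≤ K * ‖z‖) ∧
      (∀ e w w', pB ((kronId B e + w' - w) - kronVec v (wAvg 1 (kronId B e + w' - w))) ≤
        ρ * pB (e - kronVec v (wAvg 1 e)) + K * ‖w' - w‖) ∧
      ∀ x y e x' : Stacked n d, ∀ α : ℝ, 0 ≤ α → wAvg 1 y = wAvg 1 (F x) →
        x' = kronId A x - α • (y + e) →
        (α ≤ α₀ → ‖wAvg u x' - xs‖ ≤ (1 - c' * α) * ‖wAvg u x - xs‖ +
          K * α * (pA (x - kronVec 1 (wAvg u x)) + pB (y - kronVec v (wAvg 1 y)) + (1 + ‖e‖))) ∧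
        pA (x' - kronVec 1 (wAvg u x')) ≤ ρ * pA (x - kronVec 1 (wAvg u x)) +
          K * α * ((1 + ‖e‖) + ‖wAvg u x - xs‖ + pA (x - kronVec 1 (wAvg u x)) +
            pB (y - kronVec v (wAvg 1 y))) ∧
        pB ((kronId B y + F x' - F x) - kronVec v (wAvg 1 (kronId B y + F x' - F x))) ≤
          ρ * pB (y - kronVec v (wAvg 1 y)) + K * pA (x - kronVec 1 (wAvg u x)) +
          K * α * ((1 + ‖e‖) + ‖wAvg u x - xs‖ + pA (x - kronVec 1 (wAvg u x)) +
            pB (y - kronVec v (wAvg 1 y))) := by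
  have hq := h.sum_mul_pos hu0 hv0 hu hv hus hvs
  obtain ⟨r, hrA, hrB⟩ := h.common_root
  have hn : (0 : ℝ) < n := by exact_mod_cast r.pos
  obtain ⟨pA, ρA, cA, hA0, hA1, hcA, hA2, hA3, hA4⟩ := exists_row_contraction (d := d)
    h.A_nonneg h.A_row h.A_diag hu0 hu hus hrA
  obtain ⟨pB, ρB, cB, hB0, hB1, hcB, hB2, hB3, hB4⟩ := exists_column_contraction (d := d)
    h.B_nonneg h.B_col h.B_diag hv0 hv hvs hrB
  obtain ⟨q, hqdef⟩ : ∃ t, t = ∑ i, u i * v i := ⟨_, rfl⟩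
  rw [← hqdef] at hq
  obtain ⟨b₁, hb₁⟩ : ∃ t, t = ‖kronVecCLM d v‖ := ⟨_, rfl⟩
  obtain ⟨b₂, hb₂⟩ : ∃ t, t = ‖wAvgCLM d (1 : Fin n → ℝ)‖ := ⟨_, rfl⟩
  obtain ⟨b₃, hb₃⟩ : ∃ t, t = ‖F (kronVec 1 xs)‖ := ⟨_, rfl⟩
  obtain ⟨b₄, hb₄⟩ : ∃ t, t = ‖kronVecCLM d (1 : Fin n → ℝ)‖ := ⟨_, rfl⟩
  obtain ⟨w, hw⟩ : ∃ t, t = ‖wAvgCLM d u‖ := ⟨_, rfl⟩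
  obtain ⟨mA, hmA⟩ : ∃ t, t = 1 + ‖kronCLM d (avgMatrix u)‖ := ⟨_, rfl⟩
  obtain ⟨mB, hmB⟩ : ∃ t, t = 1 + ‖kronCLM d (avgMatrix v).transpose‖ := ⟨_, rfl⟩
  obtain ⟨nA, hnA⟩ : ∃ t, t = ‖kronCLM d A‖ + 1 := ⟨_, rfl⟩
  -- Chosen so that `‖y + e‖ ≤ K₁ * ((1 + ‖e‖) + X + C + Y)`; the `1` beside `‖e‖` absorbs the value
  -- of `F` at the optimum.
  obtain ⟨K₁, hK₁⟩ : ∃ t, t = 1 + b₁ * (b₂ * (b₃ + ℓ * (1 + b₄))) := ⟨_, rfl⟩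
  have hb₁0 : 0 ≤ b₁ := hb₁ ▸ norm_nonneg _
  have hb₂0 : 0 ≤ b₂ := hb₂ ▸ norm_nonneg _
  have hb₃0 : 0 ≤ b₃ := hb₃ ▸ norm_nonneg _
  have hb₄0 : 0 ≤ b₄ := hb₄ ▸ norm_nonneg _
  have hw0 : 0 ≤ w := hw ▸ norm_nonneg _
  have hmA0 : 0 ≤ mA := by rw [hmA]; positivity
  have hmB0 : 0 ≤ mB := by rw [hmB]; positivity
  have hnA0 : 0 ≤ nA := by rw [hnA]; positivity
  have hK₁0 : 0 ≤ K₁ := by rw [hK₁]; positivity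
  obtain ⟨k₁, hk₁⟩ : ∃ t, t = w + q / n * (b₂ * ℓ) := ⟨_, rfl⟩
  obtain ⟨k₂, hk₂⟩ : ∃ t, t = cA * (mA * K₁) := ⟨_, rfl⟩
  obtain ⟨k₃, hk₃⟩ : ∃ t, t = cB * (mB * (ℓ * nA)) := ⟨_, rfl⟩
  obtain ⟨k₄, hk₄⟩ : ∃ t, t = cB * (mB * (ℓ * K₁)) := ⟨_, rfl⟩
  obtain ⟨k₅, hk₅⟩ : ∃ t, t = cB * mB := ⟨_, rfl⟩
  have hk₁0 : 0 ≤ k₁ := by rw [hk₁]; positivity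
  have hk₂0 : 0 ≤ k₂ := by rw [hk₂]; positivity
  have hk₃0 : 0 ≤ k₃ := by rw [hk₃]; positivity
  have hk₄0 : 0 ≤ k₄ := by rw [hk₄]; positivity
  have hk₅0 : 0 ≤ k₅ := by rw [hk₅]; positivity
  obtain ⟨K, hK⟩ : ∃ K, K = cA + cB + k₁ + k₂ + k₃ + k₄ + k₅ := ⟨_, rfl⟩
  have hK0 : 0 < K := by linarith
  -- Rate and threshold are those of the gradient step, rescaled by the effective step `q / n ^ 2 *
  -- α`.
  refine ⟨pA, pB, max ρA ρB, K, c * (q / n ^ 2), γ₀ / (q / n ^ 2), le_max_of_le_left hA0,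
    max_lt hA1 hB1, hK0, by positivity, by positivity, hA2, hB2, fun z => (hA3 z).trans ?_,
    fun z => (hB3 z).trans ?_, fun e w₁ w₂ => ?_, fun x y e x' α hα hy hx' => ?_⟩
  · gcongr; linarith
  · gcongr; linarith
  · refine (tracking_step hcB.le hB3 hB4 e w₁ w₂).trans ?_
    rw [← hmB, ← mul_assoc, ← hk₅]
    gcongr
    · exact le_max_right _ _
    · linarith
  · have e1 := optimality_step (e := e) hn (hqdef ▸ hq.le) hu hF hFD hD hy hα
    have e2 := norm_tracker_le (u := u) (v := v) (xs := xs) hℓ hF hy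
    have e3 := consensus_step (y := y + e) (x := x) hcA.le hA3 hA4 hα
    have e4 := tracking_step hcB.le hB3 hB4 y (F x) (F x')
    have e5 := norm_increment_le (u := u) (x := x) (y := y + e) h.A_row hα
    have e6 := hF x' x
    rw [← hx'] at e1 e3 e5
    rw [← hqdef, ← hb₂, ← hw] at e1
    rw [← hb₁, ← hb₂, ← hb₃, ← hb₄] at e2
    rw [← hmA] at e3
    rw [← hmB] at e4
    rw [← hnA] at e5
    have dA := hA2 (x - kronVec 1 (wAvg u x))
    have dB := hB2 (y - kronVec v (wAvg 1 y))
    have hX0 : 0 ≤ ‖wAvg u x - xs‖ := norm_nonneg _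
    have hC0 : 0 ≤ pA (x - kronVec 1 (wAvg u x)) := apply_nonneg _ _
    have hY0 : 0 ≤ pB (y - kronVec v (wAvg 1 y)) := apply_nonneg _ _
    have he0 : 0 ≤ ‖e‖ := norm_nonneg _
    have he : ‖y + e‖ ≤ ‖y‖ + ‖e‖ := norm_add_le y e
    generalize ‖wAvg u x - xs‖ = X at *
    generalize pA (x - kronVec 1 (wAvg u x)) = C at *
    generalize pB (y - kronVec v (wAvg 1 y)) = Y at *
    generalize ‖x - kronVec 1 (wAvg u x)‖ = C' at *
    generalize ‖y - kronVec v (wAvg 1 y)‖ = Y' at *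
    have hS0 : 0 ≤ (1 + ‖e‖) + X + C + Y := by positivity
    have f1 : ‖y + e‖ ≤ K₁ * ((1 + ‖e‖) + X + C + Y) := by
      have g1 : b₃ + ℓ * (C' + b₄ * X) ≤ (b₃ + ℓ * (1 + b₄)) * ((1 + ‖e‖) + X + C + Y) := by
        have a1 : b₃ * 1 ≤ b₃ * ((1 + ‖e‖) + X + C + Y) := by gcongr; linarith
        have a2 : ℓ * C' ≤ ℓ * ((1 + ‖e‖) + X + C + Y) := by gcongr; linarith
        have a3 : ℓ * b₄ * X ≤ ℓ * b₄ * ((1 + ‖e‖) + X + C + Y) := by gcongr; linarith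
        linarith
      have g2 : b₁ * (b₂ * (b₃ + ℓ * (C' + b₄ * X))) ≤
          b₁ * (b₂ * ((b₃ + ℓ * (1 + b₄)) * ((1 + ‖e‖) + X + C + Y))) := by gcongr
      rw [hK₁]
      linarith
    refine ⟨fun hα' => ?_, ?_, ?_⟩
    · refine (e1 ?_).trans ?_
      · rw [le_div_iff₀ (by positivity)] at hα'
        linarith
      · have g1 : w * Y' + q / n * (b₂ * (ℓ * C')) + w * ‖e‖ ≤ K * (C + Y + (1 + ‖e‖)) := by
          calc w * Y' + q / n * (b₂ * (ℓ * C')) + w * ‖e‖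
              ≤ w * Y + q / n * (b₂ * (ℓ * C)) + w * ‖e‖ := by gcongr
            _ ≤ k₁ * (C + Y + (1 + ‖e‖)) := by
                have a1 : 0 ≤ q / n * (b₂ * ℓ) := by positivity
                rw [hk₁]
                nlinarith [mul_nonneg hw0 hC0, mul_nonneg a1 hY0, mul_nonneg a1 he0]
            _ ≤ K * (C + Y + (1 + ‖e‖)) := by gcongr; linarith
        have g2 := mul_le_mul_of_nonneg_left g1 hα
        linarith
    · refine e3.trans ?_
      have g1 : cA * (mA * ‖y + e‖) ≤ K * ((1 + ‖e‖) + X + C + Y) := by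
        calc cA * (mA * ‖y + e‖) ≤ cA * (mA * (K₁ * ((1 + ‖e‖) + X + C + Y))) := by gcongr
          _ = k₂ * ((1 + ‖e‖) + X + C + Y) := by rw [hk₂]; ring
          _ ≤ _ := by gcongr; linarith
      have g2 := mul_le_mul_of_nonneg_left g1 hα
      have g3 : ρA * C ≤ max ρA ρB * C := by gcongr; exact le_max_left _ _
      linarith
    · refine e4.trans ?_
      have g1 : cB * (mB * ‖F x' - F x‖) ≤ K * C + K * α * ((1 + ‖e‖) + X + C + Y) := by
        calc cB * (mB * ‖F x' - F x‖)
            ≤ cB * (mB * (ℓ * (nA * C + α * (K₁ * ((1 + ‖e‖) + X + C + Y))))) := by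
              gcongr
              refine e6.trans ?_
              gcongr
              refine e5.trans ?_
              gcongr
          _ = k₃ * C + k₄ * α * ((1 + ‖e‖) + X + C + Y) := by rw [hk₃, hk₄]; ring
          _ ≤ _ := by
              gcongr
              · linarith
              · linarith
      have g3 : ρB * Y ≤ max ρA ρB * Y := by gcongr; exact le_max_right _ _
      linarith

end OneStep

/-! ### Minkowski's inequality and L² estimates -/

section SecondMoment

variable {Ω E E' : Type*} [MeasurableSpace Ω] {P : Measure Ω} [NormedAddCommGroup E]
  [NormedAddCommGroup E']

/-- Using L² norms instead of second moments keeps the pathwise linear inequalities linear, without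
cross terms. Nonnegative coefficients are essential. -/
theorem lpNorm_le_combination {f g₁ g₂ g₃ g₄ : Ω → ℝ} {a₁ a₂ a₃ a₄ : ℝ} (h₁ : MemLp g₁ 2 P)
    (h₂ : MemLp g₂ 2 P) (h₃ : MemLp g₃ 2 P) (h₄ : MemLp g₄ 2 P) (ha₁ : 0 ≤ a₁) (ha₂ : 0 ≤ a₂)
    (ha₃ : 0 ≤ a₃) (ha₄ : 0 ≤ a₄) (hf : ∀ ω, 0 ≤ f ω)
    (h : ∀ ω, f ω ≤ a₁ * g₁ ω + a₂ * g₂ ω + a₃ * g₃ ω + a₄ * g₄ ω) :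
    lpNorm f 2 P ≤ a₁ * lpNorm g₁ 2 P + a₂ * lpNorm g₂ 2 P + a₃ * lpNorm g₃ 2 P +
      a₄ * lpNorm g₄ 2 P := by
  have hs : ∀ (a : ℝ) (g : Ω → ℝ), 0 ≤ a → lpNorm (a • g) 2 P = a * lpNorm g 2 P :=
    fun a g ha => by simp [lpNorm_const_smul, abs_of_nonneg ha]
  have m₁ := h₁.const_smul a₁
  have m₂ := h₂.const_smul a₂
  have m₃ := h₃.const_smul a₃
  have m₄ := h₄.const_smul a₄
  have hle := lpNorm_mono_real (f := f) (((m₁.add m₂).add m₃).add m₄) fun ω => by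
    rw [Real.norm_of_nonneg (hf ω)]; exact h ω
  have i₁ := lpNorm_add_le ((m₁.add m₂).add m₃) (g := a₄ • g₄) one_le_two
  have i₂ := lpNorm_add_le (m₁.add m₂) (g := a₃ • g₃) one_le_two
  have i₃ := lpNorm_add_le m₁ (g := a₂ • g₂) one_le_two
  rw [hs _ _ ha₁, hs _ _ ha₂] at i₃
  rw [hs _ _ ha₃] at i₂
  rw [hs _ _ ha₄] at i₁
  linarith

theorem memLp_seminorm_comp [NormedSpace ℝ E] {p : Seminorm ℝ E} {K : ℝ}
    (hp : ∀ z, p z ≤ K * ‖z‖) {f : Ω → E}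
    (hf : MemLp f 2 P) : MemLp (fun ω => p (f ω)) 2 P := by
  have hcont : Continuous p := (LipschitzWith.of_dist_le_mul (K := K.toNNReal) fun x y => by
    rw [dist_eq_norm, dist_eq_norm, Real.norm_eq_abs]
    exact (abs_sub_map_le_sub p x y).trans ((hp _).trans
      (mul_le_mul_of_nonneg_right (Real.le_coe_toNNReal _) (norm_nonneg _)))).continuous
  refine MemLp.of_le_mul (c := K) hf (hcont.comp_aestronglyMeasurable hf.1)
    (.of_forall fun ω => ?_)
  rw [Real.norm_of_nonneg (apply_nonneg p _)]
  exact hp _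

theorem memLp_lipschitz_comp [IsFiniteMeasure P] {F : E → E'} {ℓ : ℝ} (hℓ : 0 ≤ ℓ)
    (hF : ∀ x y, ‖F x - F y‖ ≤ ℓ * ‖x - y‖) {f : Ω → E} (hf : MemLp f 2 P) :
    MemLp (fun ω => F (f ω)) 2 P := by
  have hcont : Continuous F := (LipschitzWith.of_dist_le_mul (K := ⟨ℓ, hℓ⟩) fun x y => by
    rw [dist_eq_norm, dist_eq_norm]; exact hF x y).continuous
  refine ((memLp_const ‖F 0‖).add (hf.norm.const_smul ℓ)).mono'
    (hcont.comp_aestronglyMeasurable hf.1) (.of_forall fun ω => ?_)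
  have h1 := norm_add_le (F 0) (F (f ω) - F 0)
  have h2 := hF (f ω) 0
  rw [add_sub_cancel] at h1
  rw [sub_zero] at h2
  simp only [Pi.add_apply, Pi.smul_apply, smul_eq_mul]
  linarith

theorem integral_norm_sq_le {f : Ω → E'} {c : ℝ} (hf : MemLp f 2 P) (h : lpNorm f 2 P ≤ c) :
    Integrable (fun ω => ‖f ω‖ ^ 2) P ∧ ∫ ω, ‖f ω‖ ^ 2 ∂P ≤ c ^ 2 := by
  refine ⟨hf.integrable_norm_pow two_ne_zero, ?_⟩
  have h0 : 0 ≤ ∫ ω, ‖f ω‖ ^ 2 ∂P := integral_nonneg fun ω => sq_nonneg _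
  rw [lpNorm_eq_integral_norm_rpow_toReal (by norm_num) (by norm_num) hf.1] at h
  simp only [ENNReal.toReal_ofNat, Real.rpow_ofNat] at h
  rw [← one_div, ← Real.sqrt_eq_rpow] at h
  calc ∫ ω, ‖f ω‖ ^ 2 ∂P = √(∫ ω, ‖f ω‖ ^ 2 ∂P) ^ 2 := (Real.sq_sqrt h0).symm
    _ ≤ c ^ 2 := pow_le_pow_left₀ (Real.sqrt_nonneg _) h 2

end SecondMoment

/-! ### The tracked noise in L² -/

section NoiseTracking

variable {n d : ℕ} {Ω : Type*} [MeasurableSpace Ω] {P : Measure Ω}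
  {B : Matrix (Fin n) (Fin n) ℝ} {v : Fin n → ℝ}

theorem memLp_kronId (M : Matrix (Fin n) (Fin n) ℝ) {f : Ω → Stacked n d} (hf : MemLp f 2 P) :
    MemLp (fun ω => kronId M (f ω)) 2 P :=
  (kronCLM d M).comp_memLp' hf

theorem memLp_disagreement (w w' : Fin n → ℝ) {f : Ω → Stacked n d} (hf : MemLp f 2 P) :
    MemLp (fun ω => f ω - kronVec w (wAvg w' (f ω))) 2 P :=
  hf.sub ((kronVecCLM d w).comp_memLp' ((wAvgCLM d w').comp_memLp' hf))

theorem memLp_tracker {c : ℕ → Ω → Stacked n d} (hc : ∀ k, MemLp (c k) 2 P) (k : ℕ) :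
    MemLp (fun ω => tracker B (fun t => c t ω) k) 2 P := by
  induction k with
  | zero => exact hc 0
  | succ k ih => exact ((memLp_kronId B ih).add (hc (k + 1))).sub (hc k)

/-- Tracking a bounded noise sequence keeps it bounded in `L²`. -/
theorem exists_tracker_noise_bound (hB : ∀ j, ∑ i, B i j = 1) {p : Seminorm ℝ (Stacked n d)}
    {ρ K : ℝ} (hρ0 : 0 ≤ ρ) (hρ1 : ρ < 1) (hK : 0 ≤ K) (hp : ∀ z, ‖z‖ ≤ p z)
    (hpK : ∀ z, p z ≤ K * ‖z‖)
    (hstep : ∀ e w w', p ((kronId B e + w' - w) - kronVec v (wAvg 1 (kronId B e + w' - w))) ≤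
      ρ * p (e - kronVec v (wAvg 1 e)) + K * ‖w' - w‖)
    {ε : ℕ → Ω → Stacked n d} {σ : ℝ} (hε : ∀ k, MemLp (ε k) 2 P)
    (hσ : ∀ k, lpNorm (ε k) 2 P ≤ σ) :
    ∃ τ : ℝ, 0 ≤ τ ∧ ∀ k, lpNorm (fun ω => tracker B (fun t => ε t ω) k) 2 P ≤ τ := by
  set S : ℕ → Ω → ℝ := fun k ω => p (tracker B (fun t => ε t ω) k -
    kronVec v (wAvg 1 (tracker B (fun t => ε t ω) k))) with hS
  have hSm : ∀ k, MemLp (S k) 2 P := fun k =>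
    memLp_seminorm_comp hpK (memLp_disagreement v 1 (memLp_tracker hε k))
  have hn : ∀ k, lpNorm (fun ω => ‖ε k ω‖) 2 P ≤ σ := fun k => by
    rw [lpNorm_norm (hε k).1]; exact hσ k
  have hσ0 : 0 ≤ σ := lpNorm_nonneg.trans (hσ 0)
  have h1 : ∀ k, lpNorm (S (k + 1)) 2 P ≤ ρ * lpNorm (S k) 2 P + 2 * K * σ := fun k => by
    -- Only three terms occur; the fourth slot has coefficient zero.
    have h2 := lpNorm_le_combination (f := S (k + 1)) (hSm k) (hε (k + 1)).norm (hε k).norm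
      (hε k).norm hρ0 hK hK le_rfl (fun ω => apply_nonneg p _) fun ω => by
        have h3 := hstep (tracker B (fun t => ε t ω) k) (ε k ω) (ε (k + 1) ω)
        have h4 := mul_le_mul_of_nonneg_left (norm_sub_le (ε (k + 1) ω) (ε k ω)) hK
        change S (k + 1) ω ≤ ρ * S k ω + _ at h3
        linarith
    have h5 := mul_le_mul_of_nonneg_left (hn k) hK
    have h6 := mul_le_mul_of_nonneg_left (hn (k + 1)) hK
    linarith
  -- The initial value plus the fixed point of `t ↦ ρ t + 2 K σ`: an invariant bound for the
  -- recursion.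
  set M : ℝ := lpNorm (S 0) 2 P + 2 * K * σ / (1 - ρ) with hM
  have hd : 0 ≤ 2 * K * σ / (1 - ρ) := div_nonneg (by positivity) (by linarith)
  have hM1 : 2 * K * σ ≤ (1 - ρ) * M := by
    have e : 2 * K * σ = (1 - ρ) * (2 * K * σ / (1 - ρ)) := by
      rw [mul_div_cancel₀]; linarith
    rw [e]
    refine mul_le_mul_of_nonneg_left ?_ (by linarith)
    rw [hM]
    linarith [lpNorm_nonneg (f := S 0) (p := 2) (μ := P)]
  have hSM : ∀ k, lpNorm (S k) 2 P ≤ M := fun k => by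
    induction k with
    | zero => linarith
    | succ k ih => linarith [h1 k, mul_le_mul_of_nonneg_left ih hρ0]
  set b := ‖kronVecCLM d v‖ * ‖wAvgCLM d (1 : Fin n → ℝ)‖ with hb
  have hb0 : 0 ≤ b := by positivity
  have hM0 : 0 ≤ M := lpNorm_nonneg.trans (hSM 0)
  refine ⟨M + b * σ, by positivity, fun k => ?_⟩
  have h2 := lpNorm_le_combination (f := fun ω => ‖tracker B (fun t => ε t ω) k‖) (hSm k)
    (hε k).norm (hε k).norm (hε k).norm zero_le_one hb0 le_rfl le_rfl (fun ω => norm_nonneg _)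
    fun ω => by
      have h3 := norm_add_le (tracker B (fun t => ε t ω) k -
        kronVec v (wAvg 1 (tracker B (fun t => ε t ω) k)))
        (kronVec v (wAvg 1 (tracker B (fun t => ε t ω) k)))
      have h4 : ‖kronVec v (wAvg 1 (tracker B (fun t => ε t ω) k))‖ ≤ b * ‖ε k ω‖ := by
        rw [wAvg_one_tracker hB, hb, mul_assoc]
        exact ((kronVecCLM d v).le_opNorm _).trans
          (mul_le_mul_of_nonneg_left ((wAvgCLM d 1).le_opNorm _) (norm_nonneg _))
      have h5 : _ ≤ S k ω := hp _
      rw [sub_add_cancel] at h3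
      linarith
  rw [lpNorm_norm (memLp_tracker hε k).1] at h2
  have h5 := mul_le_mul_of_nonneg_left (hn k) hb0
  linarith [hSM k]

end NoiseTracking

/-! ### From pathwise inequalities to second moments -/

/-- Boundedness in `L²` of the optimality gap, and decay of the disagreements at the rate of the
step size, for tracking iterations driven by a perturbation bounded in `L²`. -/
theorem exists_second_moment_bound {n d : ℕ} {Ω : Type*} [MeasurableSpace Ω] {P : Measure Ω}
    [IsProbabilityMeasure P] {pA pB : Seminorm ℝ (Stacked n d)} {u v : Fin n → ℝ}
    {ρ K c α₀ τ : ℝ} {xs : Vec d} (hρ0 : 0 ≤ ρ) (hρ1 : ρ < 1) (hK : 0 < K) (hc : 0 < c)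
    (hα₀ : 0 < α₀) (hpA : ∀ z, ‖z‖ ≤ pA z) (hpB : ∀ z, ‖z‖ ≤ pB z)
    (hpAK : ∀ z, pA z ≤ K * ‖z‖) (hpBK : ∀ z, pB z ≤ K * ‖z‖)
    {x y e : ℕ → Ω → Stacked n d} (hx : ∀ k, MemLp (x k) 2 P) (hy : ∀ k, MemLp (y k) 2 P)
    (he : ∀ k, MemLp (e k) 2 P) (hτ : ∀ k, lpNorm (e k) 2 P ≤ τ) {α : ℕ → ℝ}
    (hα : ∀ k, 0 < α k) (hα0 : Filter.Tendsto α Filter.atTop (nhds 0))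
    (hratio : ∀ r : ℝ, 1 < r → ∀ᶠ k in Filter.atTop, α k ≤ r * α (k + 1))
    (h1 : ∀ k ω, α k ≤ α₀ → ‖wAvg u (x (k + 1) ω) - xs‖ ≤
      (1 - c * α k) * ‖wAvg u (x k ω) - xs‖ + K * α k * (pA (x k ω - kronVec 1 (wAvg u (x k ω))) +
        pB (y k ω - kronVec v (wAvg 1 (y k ω))) + (1 + ‖e k ω‖)))
    (h2 : ∀ k ω, pA (x (k + 1) ω - kronVec 1 (wAvg u (x (k + 1) ω))) ≤
      ρ * pA (x k ω - kronVec 1 (wAvg u (x k ω))) + K * α k * ((1 + ‖e k ω‖) +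
        ‖wAvg u (x k ω) - xs‖ + pA (x k ω - kronVec 1 (wAvg u (x k ω))) +
        pB (y k ω - kronVec v (wAvg 1 (y k ω)))))
    (h3 : ∀ k ω, pB (y (k + 1) ω - kronVec v (wAvg 1 (y (k + 1) ω))) ≤
      ρ * pB (y k ω - kronVec v (wAvg 1 (y k ω))) +
        K * pA (x k ω - kronVec 1 (wAvg u (x k ω))) + K * α k * ((1 + ‖e k ω‖) +
        ‖wAvg u (x k ω) - xs‖ + pA (x k ω - kronVec 1 (wAvg u (x k ω))) +
        pB (y k ω - kronVec v (wAvg 1 (y k ω))))) :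
    ∃ U : ℝ, 0 < U ∧ ∀ k : ℕ,
      (Integrable (fun ω => ‖wAvg u (x k ω) - xs‖ ^ 2) P ∧
        ∫ ω, ‖wAvg u (x k ω) - xs‖ ^ 2 ∂P ≤ U) ∧
      (Integrable (fun ω => ‖x k ω - kronVec 1 (wAvg u (x k ω))‖ ^ 2) P ∧
        ∫ ω, ‖x k ω - kronVec 1 (wAvg u (x k ω))‖ ^ 2 ∂P ≤ U * α k ^ 2) ∧
      (Integrable (fun ω => ‖y k ω - kronVec v (wAvg 1 (y k ω))‖ ^ 2) P ∧
        ∫ ω, ‖y k ω - kronVec v (wAvg 1 (y k ω))‖ ^ 2 ∂P ≤ U * α k ^ 2) := by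
  have mX : ∀ k, MemLp (fun ω => wAvg u (x k ω) - xs) 2 P := fun k =>
    ((wAvgCLM d u).comp_memLp' (hx k)).sub (memLp_const xs)
  have mC : ∀ k, MemLp (fun ω => x k ω - kronVec 1 (wAvg u (x k ω))) 2 P := fun k =>
    memLp_disagreement 1 u (hx k)
  have mY : ∀ k, MemLp (fun ω => y k ω - kronVec v (wAvg 1 (y k ω))) 2 P := fun k =>
    memLp_disagreement v 1 (hy k)
  have mX' : ∀ k, MemLp (fun ω => ‖wAvg u (x k ω) - xs‖) 2 P := fun k => (mX k).norm
  have mC' := fun k => memLp_seminorm_comp hpAK (mC k)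
  have mY' := fun k => memLp_seminorm_comp hpBK (mY k)
  have mH : ∀ k, MemLp (fun ω => 1 + ‖e k ω‖) 2 P := fun k => (memLp_const (1 : ℝ)).add (he k).norm
  have hτ0 : 0 ≤ τ := lpNorm_nonneg.trans (hτ 0)
  have hH : ∀ k, lpNorm (fun ω => 1 + ‖e k ω‖) 2 P ≤ 1 + τ := fun k => by
    refine (lpNorm_add_le (memLp_const (1 : ℝ)) (g := fun ω => ‖e k ω‖) one_le_two).trans ?_
    rw [lpNorm_norm (he k).1, lpNorm_const two_ne_zero (IsProbabilityMeasure.ne_zero P)]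
    have := hτ k
    simpa using this
  suffices h : ∃ U : ℝ, 0 < U ∧ ∀ k, lpNorm (fun ω => ‖wAvg u (x k ω) - xs‖) 2 P ≤ U ∧
      lpNorm (fun ω => pA (x k ω - kronVec 1 (wAvg u (x k ω)))) 2 P ≤ U * α k ∧
      lpNorm (fun ω => pB (y k ω - kronVec v (wAvg 1 (y k ω)))) 2 P ≤ U * α k by
    obtain ⟨U, hU0, hU⟩ := h
    refine ⟨U ^ 2, by positivity, fun k => ⟨?_, ?_, ?_⟩⟩
    · refine integral_norm_sq_le (mX k) ?_
      rw [← lpNorm_norm (mX k).1]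
      exact (hU k).1
    · rw [← mul_pow]
      refine integral_norm_sq_le (mC k) ((lpNorm_mono_real (mC' k) fun ω => hpA _).trans ?_)
      exact (hU k).2.1
    · rw [← mul_pow]
      refine integral_norm_sq_le (mY k) ((lpNorm_mono_real (mY' k) fun ω => hpB _).trans ?_)
      exact (hU k).2.2
  -- The L² norm of `1 + ‖e k‖` is at most `1 + τ`, whence the new `K`. The threshold `1 / c` keeps
  -- the coefficient `1 - c * α k` nonnegative, as Minkowski needs.
  refine coupled_recursion_bound (α := α)
    (X := fun k => lpNorm (fun ω => ‖wAvg u (x k ω) - xs‖) 2 P)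
    (C := fun k => lpNorm (fun ω => pA (x k ω - kronVec 1 (wAvg u (x k ω)))) 2 P)
    (Y := fun k => lpNorm (fun ω => pB (y k ω - kronVec v (wAvg 1 (y k ω)))) 2 P)
    (c := c) (K := K * (1 + τ)) (ρ := ρ) (α₀ := min α₀ (1 / c)) hα hα0 hratio
    (fun _ => lpNorm_nonneg) (fun _ => lpNorm_nonneg) (fun _ => lpNorm_nonneg) hc (by positivity)
    (by positivity) hρ0 hρ1 (fun k hk => ?_) (fun k => ?_) (fun k => ?_)
  all_goals
    have ak := hα k
    have hKα : 0 ≤ K * α k := by positivity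
    have hHk := hH k
    have nX := lpNorm_nonneg (f := fun ω => ‖wAvg u (x k ω) - xs‖) (p := 2) (μ := P)
    have nC := lpNorm_nonneg (f := fun ω => pA (x k ω - kronVec 1 (wAvg u (x k ω))))
      (p := 2) (μ := P)
    have nY := lpNorm_nonneg (f := fun ω => pB (y k ω - kronVec v (wAvg 1 (y k ω))))
      (p := 2) (μ := P)
  · have hcα : 0 ≤ 1 - c * α k := by
      have := hk.trans (min_le_right _ _)
      rw [le_div_iff₀ hc] at this
      linarith
    have hL := lpNorm_le_combination (mX' k) (mC' k) (mY' k) (mH k) hcα hKα hKα hKα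
      (f := fun ω => ‖wAvg u (x (k + 1) ω) - xs‖) (fun ω => norm_nonneg _) fun ω => by
        linarith [h1 k ω (hk.trans (min_le_left _ _))]
    refine hL.trans ?_
    generalize lpNorm (fun ω => ‖wAvg u (x k ω) - xs‖) 2 P = X at *
    generalize lpNorm (fun ω => pA (x k ω - kronVec 1 (wAvg u (x k ω)))) 2 P = C at *
    generalize lpNorm (fun ω => pB (y k ω - kronVec v (wAvg 1 (y k ω)))) 2 P = Y at *
    have g1 := mul_le_mul_of_nonneg_left hHk hKα
    have g2 : 0 ≤ K * α k * (τ * (C + Y)) := by positivity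
    linarith
  · have hL := lpNorm_le_combination (mC' k) (mX' k) (mY' k) (mH k)
      (add_nonneg hρ0 hKα) hKα hKα hKα
      (f := fun ω => pA (x (k + 1) ω - kronVec 1 (wAvg u (x (k + 1) ω))))
      (fun ω => apply_nonneg _ _) fun ω => by linarith [h2 k ω]
    refine hL.trans ?_
    generalize lpNorm (fun ω => ‖wAvg u (x k ω) - xs‖) 2 P = X at *
    generalize lpNorm (fun ω => pA (x k ω - kronVec 1 (wAvg u (x k ω)))) 2 P = C at *
    generalize lpNorm (fun ω => pB (y k ω - kronVec v (wAvg 1 (y k ω)))) 2 P = Y at *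
    have g1 := mul_le_mul_of_nonneg_left hHk hKα
    have g2 : 0 ≤ K * α k * (τ * (X + C + Y)) := by positivity
    linarith
  · have hL := lpNorm_le_combination (mC' k) (mX' k) (mY' k) (mH k)
      (add_nonneg hK.le hKα) hKα (add_nonneg hρ0 hKα) hKα
      (f := fun ω => pB (y (k + 1) ω - kronVec v (wAvg 1 (y (k + 1) ω))))
      (fun ω => apply_nonneg _ _) fun ω => by linarith [h3 k ω]
    refine hL.trans ?_
    generalize lpNorm (fun ω => ‖wAvg u (x k ω) - xs‖) 2 P = X at *
    generalize lpNorm (fun ω => pA (x k ω - kronVec 1 (wAvg u (x k ω)))) 2 P = C at *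
    generalize lpNorm (fun ω => pB (y k ω - kronVec v (wAvg 1 (y k ω)))) 2 P = Y at *
    have g1 := mul_le_mul_of_nonneg_left hHk hKα
    have g2 : 0 ≤ K * α k * (τ * (X + C + Y)) := by positivity
    have g3 : 0 ≤ K * τ * C := by positivity
    linarith

end SAB

/-! ### Assembly -/

theorem lemma2 {n d : ℕ} {Ω : Type*} [MeasurableSpace Ω] (P : Measure Ω) [IsProbabilityMeasure P]
    {Ξ : Fin n → Type*} [∀ i, MeasurableSpace (Ξ i)]
    -- the sampled costs `g i x z`, the random variables `ζ i`, and the Lipschitz moduli `Lip i`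
    (g : (i : Fin n) → SAB.Vec d → Ξ i → ℝ) (ζ : (i : Fin n) → Ω → Ξ i)
    (Lip : (i : Fin n) → Ξ i → ℝ)
    (hζ : ∀ i, Measurable (ζ i)) (hg : ∀ i x, Measurable (g i x))
    (hg_int : ∀ i x, Integrable (fun ω => g i x (ζ i ω)) P) (hLip : ∀ i, Measurable (Lip i))
    -- an optimal solution and the assumption on the objective
    (xs : SAB.Vec d) (hxs : ∀ x, SAB.cost P g ζ xs ≤ SAB.cost P g ζ x)
    (hobj : SAB.ObjectiveAssumption P g ζ Lip xs)
    -- the weight matrices and their Perron vectors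
    (A B : Matrix (Fin n) (Fin n) ℝ) (hmat : SAB.MatrixAssumption A B)
    (u v : Fin n → ℝ) (hu_nonneg : ∀ i, 0 ≤ u i) (hv_nonneg : ∀ i, 0 ≤ v i)
    (hu : Matrix.vecMul u A = u) (hv : Matrix.mulVec B v = v)
    (hu_sum : ∑ i, u i = (n : ℝ)) (hv_sum : ∑ i, v i = (n : ℝ))
    -- the samples: `Z i k` is distributed as `ζ i`, and independent over time
    (Z : (i : Fin n) → ℕ → Ω → Ξ i) (hZ : ∀ i k, Measurable (Z i k))
    (hZ_dist : ∀ i k, IdentDistrib (Z i k) (ζ i) P P)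
    (hZ_indep : iIndepFun (fun (k : ℕ) (ω : Ω) (i : Fin n) => Z i k ω) P)
    -- the step size
    (a b s : ℝ) (ha : 0 < a) (hb : 0 < b) (hs : 1 / 2 < s) (hs' : s ≤ 1)
    (hab : a / b ^ s ≤ min 1 ((n : ℝ) / ((∑ i, u i * v i) * SAB.lipConst P ζ Lip)))
    -- the iterates `x_k` and the noise-free tracker `y'_k`
    (x₀ : SAB.Stacked n d) (x y' : ℕ → Ω → SAB.Stacked n d)
    (hx : ∀ k ω, x k ω = SAB.iterX A B g (SAB.stepSize a b s) x₀ (fun i t => Z i t ω) k)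
    (hy' : ∀ k ω, y' k ω =
      SAB.tracker B (fun t => SAB.gradStack (SAB.localCost P g ζ) (x t ω)) k) :
    ∃ U₂ : ℝ, 0 < U₂ ∧ ∀ k : ℕ,
      (Integrable (fun ω => ‖SAB.wAvg u (x k ω) - xs‖ ^ 2) P ∧
        ∫ ω, ‖SAB.wAvg u (x k ω) - xs‖ ^ 2 ∂P ≤ U₂) ∧
      (Integrable (fun ω => ‖x k ω - SAB.kronVec 1 (SAB.wAvg u (x k ω))‖ ^ 2) P ∧
        ∫ ω, ‖x k ω - SAB.kronVec 1 (SAB.wAvg u (x k ω))‖ ^ 2 ∂P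
          ≤ U₂ * SAB.stepSize a b s k ^ 2) ∧
      (Integrable (fun ω => ‖y' k ω - SAB.kronVec v (SAB.wAvg 1 (y' k ω))‖ ^ 2) P ∧
        ∫ ω, ‖y' k ω - SAB.kronVec v (SAB.wAvg 1 (y' k ω))‖ ^ 2 ∂P
          ≤ U₂ * SAB.stepSize a b s k ^ 2) := by
  obtain ⟨μ, hμ, hsc⟩ := hobj.strongly_convex
  have hsm := hobj.localCost_smooth hζ hg hg_int hLip
  have hℓ0 : ∀ i, 0 ≤ ∫ ω, Lip i (ζ i ω) ∂P := fun i =>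
    integral_nonneg fun ω => (hobj.lip_pos i _).le
  have hF := SAB.gradStack_lipschitz hℓ0 fun i => (hsm i).2
  have hD : ∀ x y : SAB.Vec d, ‖gradient (SAB.cost P g ζ) x - gradient (SAB.cost P g ζ) y‖ ≤
      (∑ i, ∫ ω, Lip i (ζ i ω) ∂P) * ‖x - y‖ := fun x y => by
    rw [SAB.gradient_cost fun i => (hsm i).1, SAB.gradient_cost fun i => (hsm i).1,
      ← Finset.sum_sub_distrib, Finset.sum_mul]
    exact (norm_sum_le _ _).trans (Finset.sum_le_sum fun i _ => (hsm i).2 x y)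
  obtain ⟨c, γ₀, hc, hγ₀, hcontr⟩ := SAB.exists_gradient_step_contraction hμ hsc hD hxs
  obtain ⟨pA, pB, ρ, K, c', α₀, hρ0, hρ1, hK, hc', hα₀, hpA, hpB, hpAK, hpBK, hnoise, hstep⟩ :=
    hmat.exists_one_step_bounds hu_nonneg hv_nonneg hu hv hu_sum hv_sum
      (Finset.sum_nonneg fun i _ => hℓ0 i) hc hγ₀ hF
      (SAB.wAvg_one_gradStack fun i => (hsm i).1) hcontr
  have hgm := hobj.measurable_gradient hg
  have hxm : ∀ k, Measurable (x k) := fun k => by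
    rw [funext (hx k)]
    exact (SAB.measurable_iter hgm k).fst.comp
      (measurable_pi_lambda _ fun i => measurable_pi_lambda _ fun t => hZ i t)
  obtain ⟨σ, -, hσ⟩ := hobj.exists_noise_bound hζ hg hg_int hLip hZ hZ_dist hxm fun k => by
    rw [funext (hx k)]
    exact SAB.indepFun_iterX hgm hZ hZ_indep k
  set ε : ℕ → Ω → SAB.Stacked n d := fun k ω =>
    SAB.gradStack (fun i w => g i w (Z i k ω)) (x k ω) -
      SAB.gradStack (SAB.localCost P g ζ) (x k ω) with hε
  set e : ℕ → Ω → SAB.Stacked n d := fun k ω => SAB.tracker B (fun t => ε t ω) k with he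
  have hem : ∀ k, MemLp (e k) 2 P := SAB.memLp_tracker fun k => (hσ k).1
  obtain ⟨τ, -, hτ⟩ := SAB.exists_tracker_noise_bound hmat.B_col hρ0 hρ1 hK.le hpB hpBK hnoise
    (fun k => (hσ k).1) fun k => (hσ k).2
  -- By linearity the stochastic tracker is `y' + e`, so the method becomes a noise-free tracking
  -- iteration with an additive perturbation of the direction.
  have hx_succ : ∀ k ω, x (k + 1) ω =
      SAB.kronId A (x k ω) - SAB.stepSize a b s k • (y' k ω + e k ω) := fun k ω => by
    have h1 : (fun t => SAB.gradStack (fun i w => g i w (Z i t ω)) (x t ω)) =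
        fun t => SAB.gradStack (SAB.localCost P g ζ) (x t ω) + ε t ω := by
      funext t
      simp only [hε, add_sub_cancel]
    rw [hx (k + 1), SAB.iterX_succ, SAB.iter_snd_eq_tracker, hy', he, ← SAB.tracker_add, ← h1]
    simp only [hx]
  have hy_succ : ∀ k ω, y' (k + 1) ω = SAB.kronId B (y' k ω) +
      SAB.gradStack (SAB.localCost P g ζ) (x (k + 1) ω) -
        SAB.gradStack (SAB.localCost P g ζ) (x k ω) := fun k ω => by
    rw [hy', hy']; rfl
  have hFm : ∀ k, MemLp (x k) 2 P →
      MemLp (fun ω => SAB.gradStack (SAB.localCost P g ζ) (x k ω)) 2 P := fun k hk =>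
    SAB.memLp_lipschitz_comp (Finset.sum_nonneg fun i _ => hℓ0 i) hF hk
  -- Square integrability at each time, with no uniformity in `k`, must be known before norms can be
  -- compared; the two sequences feed each other, hence the joint induction.
  have hmem : ∀ k, MemLp (x k) 2 P ∧ MemLp (y' k) 2 P := fun k => by
    induction k with
    | zero =>
      have h0 : MemLp (x 0) 2 P := by
        rw [funext (hx 0)]; exact memLp_const x₀
      refine ⟨h0, ?_⟩
      rw [funext (hy' 0)]
      exact hFm 0 h0
    | succ k ih =>
      have h1 : MemLp (x (k + 1)) 2 P := by
        rw [funext (hx_succ k)]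
        exact (SAB.memLp_kronId A ih.1).sub ((ih.2.add (hem k)).const_smul (SAB.stepSize a b s k))
      refine ⟨h1, ?_⟩
      rw [funext (hy_succ k)]
      exact ((SAB.memLp_kronId B ih.2).add (hFm _ h1)).sub (hFm _ ih.1)
  have hα := SAB.stepSize_pos (s := s) ha hb
  have hall := fun k ω => hstep (x k ω) (y' k ω) (e k ω) (x (k + 1) ω) (SAB.stepSize a b s k)
    (hα k).le (by rw [hy', SAB.wAvg_one_tracker hmat.B_col]) (hx_succ k ω)
  exact SAB.exists_second_moment_bound hρ0 hρ1 hK hc' hα₀ hpA hpB hpAK hpBK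
    (fun k => (hmem k).1) (fun k => (hmem k).2) hem hτ hα (SAB.tendsto_stepSize (by linarith))
    (fun r hr => SAB.stepSize_le_mul_succ ha hb (by linarith) hs' hr)
    (fun k ω => (hall k ω).1) (fun k ω => (hall k ω).2.1)
    (fun k ω => by rw [hy_succ]; exact (hall k ω).2.2)
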